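/- Let $\mathcal L$ be a first-order signature. Approximate measure logic (AML) extends first-order logic over $\mathcal L$ by the formulas $m_{\vec x}<q.\varphi$ and $m_{\vec x}\le q.\varphi$, where $\vec x$ is a tuple of $k\ge 1$ distinct variables (bound in the new formula) and $q\ge 0$ is rational. An AML quasistructure is a first-order structure with universe $N$ together with, for each $n\ge1$, an algebra $\mathcal B_n$ of subsets of $N^n$, a finitely additive measure $\mu_n:\mathcal B_n\to[0,\infty]$ such that $X\times Y\in\mathcal B_{m+n}$ and $\mu_{m+n}(X\times Y)=\mu_m(X)\mu_n(Y)$ for $X\in\mathcal B_m$, $Y\in\mathcal B_n$, and a tag $v(X)\in\{\oplus,\ominus,\odot\}$ for each $X\in\mathcal B_n$, with $v(X)=\odot$ unless $\mu_n(X)\in\mathbb Q$. It satisfies $m_{\vec x}<q.\varphi$ if the set $X$ of the tuples $\vec x$ satisfying $\varphi$ has $\mu(X)<q$, or $\mu(X)=q$ and $v(X)=\ominus$; it satisfies $m_{\vec x}\le q.\varphi$ if $\mu(X)<q$, or $\mu(X)=q$ and $v(X)\ne\oplus$; the other connectives and quantifiers are interpreted as usual. An AML structure is a quasistructure in which every set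 definable by an AML formula with parameters belongs to the relevant algebra. $\mathfrak M$ is an elementary substructure of $\mathfrak N$ ($\mathfrak M\preceq\mathfrak N$) if its first-order part is a substructure, $B\cap M^n\in\mathcal B_n^{\mathfrak M}$ for all $B\in\mathcal B^{\mathfrak N}_n$, and $\mathfrak M$ and $\mathfrak N$ satisfy the same AML formulas at all tuples from $M$. An AML structure $\mathfrak N$ is measured if for each $n\ge1$ it carries a countably additive measure $\mu^n$ on a $\sigma$-algebra of subsets of $N^n$ containing all definable sets, such that $\mu^n=\mu_n$ on definable sets, $\mu^{m+n}$ extends $\mu^m\otimes\mu^n$, and the Fubini property holds: for every $\mu^{m+n}$-measurable $B\subseteq N^{m+n}$, almost all sections of $B$ in $N^n$ and in $N^m$ are measurable, their measures are measurable functions of the remaining coordinates, and $\mu^{m+n}(B)$ equals both iterated integrals. For $1\le n$, $I\subseteq[1,n]$ and $A\subseteq N$ let $\mathcal B^0_{n,I}(A)$ be the Boolean algebra of subsets of $N^n$ generated by the sets $\{(x_1,\dots,x_n):\mathfrak N\models\varphi(x_1,\dots,x_n)\}$, where $\varphi$ is an AML formula with parameters from $A$ whose free variables are among the $x_i$, $i\in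 I$; let $\mathcal B_{n,I}(A)$ be the $\sigma$-algebra generated by $\mathcal B^0_{n,I}(A)$. **Theorem (infinitary hypergraph removal).** Let $\mathfrak N$ be a measured AML structure with $0<\mu^1(N)<\infty$, and let $\mathfrak M$ be an AML structure which is an elementary substructure of $\mathfrak N$. Let $n\ge1$, $n\ge k\ge 0$ and $\mathcal I\subseteq\binom{[1,n]}{k}$, and for each $I\in\mathcal I$ let $A_I\in\mathcal B_{n,I}(M)$. Suppose there is a $\delta>0$ such that whenever $B_I\in\mathcal B^0_{n,I}(M)$ and $\mu^n(A_I\setminus B_I)<\delta$ for all $I\in\mathcal I$, the intersection $\bigcap_{I\in\mathcal I}B_I$ is non-empty. Then $\mu^n\bigl(\bigcap_{I\in\mathcal I}A_I\bigr)>0$. (An intersection over the empty family is $N^n$.) -/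

import Mathlib

open FirstOrder MeasureTheory
open scoped ENNReal NNReal

universe u v w

namespace AML

/-- Formulas of approximate measure logic over a first-order signature `L`, with free variables
among `α`. A quantifier over one variable binds the new variable of `α ⊕ Unit`; the measure
constructors `m_{x₁,…,xₖ} < q. φ` and `m_{x₁,…,xₖ} ≤ q. φ` (with `k ≥ 1` and `q` a non-negative
rational) bind the `k` distinct new variables of `α ⊕ Fin k`. -/
inductive AMLFormula (L : FirstOrder.Language.{u, v}) : Type → Type (max 1 u v)
  | equal {α : Type} (t₁ t₂ : L.Term α) : AMLFormula L α
  | rel {α : Type} {l : ℕ} (R : L.Relations l) (ts : Fin l → L.Term α) : AMLFormula L α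
  | not {α : Type} (φ : AMLFormula L α) : AMLFormula L α
  | and {α : Type} (φ ψ : AMLFormula L α) : AMLFormula L α
  | ex {α : Type} (φ : AMLFormula L (α ⊕ Unit)) : AMLFormula L α
  | all {α : Type} (φ : AMLFormula L (α ⊕ Unit)) : AMLFormula L α
  | measLT {α : Type} (k : ℕ) (hk : 0 < k) (q : ℚ≥0) (φ : AMLFormula L (α ⊕ Fin k)) :
      AMLFormula L α
  | measLE {α : Type} (k : ℕ) (hk : 0 < k) (q : ℚ≥0) (φ : AMLFormula L (α ⊕ Fin k)) :
      AMLFormula L α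

/-- The three tags `⊕` (`above`), `⊖` (`below`) and `⊙` (`exact`): the measure of a set is
identified only by approximation from above, only from below, or exactly. -/
inductive Approx
  | above
  | below
  | exact

/-- The product `X × Y ⊆ M ^ (m + n)` of `X ⊆ M ^ m` and `Y ⊆ M ^ n`. -/
def rect {M : Type w} {m n : ℕ} (X : Set (Fin m → M)) (Y : Set (Fin n → M)) :
    Set (Fin (m + n) → M) :=
  {z | (fun i => z (Fin.castAdd n i)) ∈ X ∧ (fun j => z (Fin.natAdd m j)) ∈ Y}

/-- A quasistructure of approximate measure logic: a first-order structure together with, for every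
`n ≥ 1`, an algebra `alg n` of subsets of `M ^ n`, a finitely additive `[0, ∞]`-valued measure
`μ n` on it, compatible with products, and a tag for every set in the algebra, which is `exact`
unless the measure of the set is rational. (Nothing is asked, or used, for `n = 0`; the values of
`μ n` and `tag n` off `alg n` are irrelevant.) -/
structure Quasistructure (L : FirstOrder.Language.{u, v}) (M : Type w) [L.Structure M] where
  alg : ∀ n : ℕ, Set (Set (Fin n → M))
  isSetAlgebra : ∀ n, 0 < n → IsSetAlgebra (alg n)
  μ : ∀ n, AddContent ℝ≥0∞ (alg n)
  rect_mem : ∀ m n, 0 < m → 0 < n → ∀ X ∈ alg m, ∀ Y ∈ alg n, rect X Y ∈ alg (m + n)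
  μ_rect : ∀ m n, 0 < m → 0 < n → ∀ X ∈ alg m, ∀ Y ∈ alg n,
    μ (m + n) (rect X Y) = μ m X * μ n Y
  tag : ∀ n : ℕ, Set (Fin n → M) → Approx
  tag_eq_exact : ∀ n, 0 < n → ∀ X ∈ alg n,
    (∀ q : ℚ≥0, μ n X ≠ ((q : ℝ≥0) : ℝ≥0∞)) → tag n X = Approx.exact

/-- Satisfaction `𝔐 ⊨ φ[s]`. It is written as a total recursion; for a structure (see below) all
the sets that occur in the measure clauses lie in the algebras, so that it agrees with the recursion
by rank of formulas. -/
def Quasistructure.Realize {L : FirstOrder.Language.{u, v}} {M : Type w} [L.Structure M]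
    (𝔐 : Quasistructure L M) : {α : Type} → AMLFormula L α → (α → M) → Prop
  | _, .equal t₁ t₂, s => t₁.realize s = t₂.realize s
  | _, .rel R ts, s => Language.Structure.RelMap R (fun i => (ts i).realize s)
  | _, .not φ, s => ¬ 𝔐.Realize φ s
  | _, .and φ ψ, s => 𝔐.Realize φ s ∧ 𝔐.Realize ψ s
  | _, .ex φ, s => ∃ a : M, 𝔐.Realize φ (Sum.elim s (fun _ => a))
  | _, .all φ, s => ∀ a : M, 𝔐.Realize φ (Sum.elim s (fun _ => a))
  | _, .measLT k _ q φ, s =>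
      𝔐.μ k {x | 𝔐.Realize φ (Sum.elim s x)} < ((q : ℝ≥0) : ℝ≥0∞) ∨
        (𝔐.μ k {x | 𝔐.Realize φ (Sum.elim s x)} = ((q : ℝ≥0) : ℝ≥0∞) ∧
          𝔐.tag k {x | 𝔐.Realize φ (Sum.elim s x)} = Approx.below)
  | _, .measLE k _ q φ, s =>
      𝔐.μ k {x | 𝔐.Realize φ (Sum.elim s x)} < ((q : ℝ≥0) : ℝ≥0∞) ∨
        (𝔐.μ k {x | 𝔐.Realize φ (Sum.elim s x)} = ((q : ℝ≥0) : ℝ≥0∞) ∧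
          𝔐.tag k {x | 𝔐.Realize φ (Sum.elim s x)} ≠ Approx.above)

/-- `Def_n(M)`: the subsets of `M ^ n` definable by a formula with parameters from `M`. -/
def Quasistructure.Def {L : FirstOrder.Language.{u, v}} {M : Type w} [L.Structure M]
    (𝔐 : Quasistructure L M) (n : ℕ) : Set (Set (Fin n → M)) :=
  {X | ∃ (p : ℕ) (φ : AMLFormula L (Fin p ⊕ Fin n)) (b : Fin p → M),
    X = {x | 𝔐.Realize φ (Sum.elim b x)}}

/-- A structure of approximate measure logic: a quasistructure in which all definable sets are
measurable. -/
structure AMLStructure (L : FirstOrder.Language.{u, v}) (M : Type w) [L.Structure M]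
    extends Quasistructure L M where
  def_subset_alg : ∀ n, 0 < n → toQuasistructure.Def n ⊆ alg n

/-- `𝔐` is an elementary substructure of `𝔑`. The universe of `𝔐` is a first-order substructure
`M` of `N`, with the induced first-order structure. -/
structure IsElementarySubstructure {L : FirstOrder.Language.{u, v}} {N : Type w} [L.Structure N]
    {M : L.Substructure N} (𝔐 : AMLStructure L M) (𝔑 : AMLStructure L N) : Prop where
  inter_mem : ∀ n, 0 < n → ∀ B ∈ 𝔑.alg n, {x : Fin n → M | (fun i => (x i : N)) ∈ B} ∈ 𝔐.alg n
  realize_iff : ∀ (n : ℕ) (φ : AMLFormula L (Fin n)) (a : Fin n → M),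
    𝔐.Realize φ a ↔ 𝔑.Realize φ (fun i => (a i : N))

/-- A measured structure: a structure with, for every `n ≥ 1`, a (countably additive) measure `ν n`
on a σ-algebra of subsets of `M ^ n` that contains the definable sets, which agrees with `μ n` on
definable sets, extends the products of the `ν`s (that is, has the product value on measurable
rectangles), and has the Fubini property. -/
structure MeasuredStructure (L : FirstOrder.Language.{u, v}) (M : Type w) [L.Structure M]
    extends AMLStructure L M where
  [mspace : ∀ n : ℕ, MeasurableSpace (Fin n → M)]
  ν : ∀ n : ℕ, Measure (Fin n → M)
  measurableSet_of_mem_def : ∀ n, 0 < n → ∀ B ∈ toQuasistructure.Def n, MeasurableSet B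
  ν_eq_μ : ∀ n, 0 < n → ∀ B ∈ toQuasistructure.Def n, ν n B = μ n B
  measurableSet_rect : ∀ m n, 0 < m → 0 < n → ∀ (X : Set (Fin m → M)) (Y : Set (Fin n → M)),
    MeasurableSet X → MeasurableSet Y → MeasurableSet (rect X Y)
  ν_rect : ∀ m n, 0 < m → 0 < n → ∀ (X : Set (Fin m → M)) (Y : Set (Fin n → M)),
    MeasurableSet X → MeasurableSet Y → ν (m + n) (rect X Y) = ν m X * ν n Y
  fubini : ∀ m n, 0 < m → 0 < n → ∀ B : Set (Fin (m + n) → M), MeasurableSet B →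
    (∀ᵐ x ∂(ν m), MeasurableSet {y : Fin n → M | Fin.append x y ∈ B}) ∧
    (∀ᵐ y ∂(ν n), MeasurableSet {x : Fin m → M | Fin.append x y ∈ B}) ∧
    AEMeasurable (fun x => ν n {y : Fin n → M | Fin.append x y ∈ B}) (ν m) ∧
    AEMeasurable (fun y => ν m {x : Fin m → M | Fin.append x y ∈ B}) (ν n) ∧
    ν (m + n) B = ∫⁻ x, ν n {y : Fin n → M | Fin.append x y ∈ B} ∂(ν m) ∧
    ν (m + n) B = ∫⁻ y, ν m {x : Fin m → M | Fin.append x y ∈ B} ∂(ν n)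

/-- `𝓑⁰_{n,I}(A)`: the Boolean algebra of subsets of `M ^ n` generated by the sets defined by
formulas with parameters from `A` whose free variables are among the `xᵢ`, `i ∈ I`. -/
def algB {L : FirstOrder.Language.{u, v}} {M : Type w} [L.Structure M] (𝔐 : Quasistructure L M)
    (A : Set M) (n : ℕ) (I : Finset (Fin n)) : Set (Set (Fin n → M)) :=
  generateSetAlgebra {X | ∃ (p : ℕ) (φ : AMLFormula L (Fin p ⊕ I)) (b : Fin p → M),
    (∀ j, b j ∈ A) ∧ X = {x | 𝔐.Realize φ (Sum.elim b (fun i : I => x i))}}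

/-- `𝓑_{n,I}(A)`: the σ-algebra generated by `𝓑⁰_{n,I}(A)`. -/
abbrev sigmaB {L : FirstOrder.Language.{u, v}} {M : Type w} [L.Structure M] (𝔐 : Quasistructure L M)
    (A : Set M) (n : ℕ) (I : Finset (Fin n)) : MeasurableSpace (Fin n → M) :=
  MeasurableSpace.generateFrom (algB 𝔐 A n I)

end AML

namespace AML

open MeasurableSpace Set

/-! ### Approximation by an algebra, and finite partitions -/

section Partition

variable {X : Type*}

/-! Write `𝒜 S` for the algebra of sets defined over `M` in the coordinates from `S`. The proof
separates a model-theoretic input from a measure-theoretic induction.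

The input is conditional independence, `IsElementarySubstructure.condIndep`: if `f` is `𝒜
S`-measurable up to σ-completion and has integral zero over every set generated by the `𝒜 J` with `J
∈ 𝓓`, `J ⊆ S`, where `𝓓` is down-closed, then it has integral zero over every set generated by all
`𝒜 J`, `J ∈ 𝓓`. Take a basic set `G`, an intersection of sets from the `𝒜 J`. Freezing its
coordinates off `S` at a point of `M` leaves sets in `𝒜 (J ∩ S)`, with `J ∩ S ∈ 𝓓`, so the integral
of `f` over this section of `G` vanishes. Elementarity carries this, up to a small error, to frozen
coordinates from `N`, since finitely many section measures can be approximated by parameters in `M`.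
Averaging over the frozen coordinates by Fubini gives `G` itself.

The induction, `exists_removal`, runs on the size of `𝓓` and shows that sets `A i` with null
intersection are almost covered by algebra sets `B i` with empty intersection. Remove a maximal `J`
from `𝓓`. Up to small error the `A i` involve `𝒜 J` only through a finite partition, so on each cell
they become sets `C i b` of lower level, chosen so that the conditional density of `A i` there is
near 1. Independence then forces the cell and the `C i b` to have null intersection
(`measure_iInter_approx_eq_zero`). The cell is replaced by the support of its conditional
expectation on the lower level, the induction hypothesis applies in each cell, and the results are
glued. With all index sets in `𝓓`, this contradicts the hypothesis on `δ`. -/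

theorem exists_symmDiff_lt {m0 : MeasurableSpace X} (μ : Measure X) [IsFiniteMeasure μ]
    {𝒜 : Set (Set X)} (h𝒜 : IsSetAlgebra 𝒜) (hm : generateFrom 𝒜 ≤ m0) {A : Set X}
    (hA : MeasurableSet[generateFrom 𝒜] A) {ε : ℝ} (hε : 0 < ε) :
    ∃ t ∈ 𝒜, μ.real (symmDiff A t) < ε := by
  let m1 := generateFrom 𝒜
  have : IsFiniteMeasure (μ.trim hm) := isFiniteMeasure_trim hm
  obtain ⟨t, ht, h⟩ := (Measure.MeasureDense.of_generateFrom_isSetAlgebra_finite (μ.trim hm)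
    h𝒜 rfl).approx A hA (measure_ne_top _ _) ε hε
  refine ⟨t, ht, ?_⟩
  have hst : MeasurableSet[m1] (symmDiff A t) :=
    MeasurableSet.symmDiff hA (measurableSet_generateFrom ht)
  rw [trim_measurableSet_eq hm hst] at h
  exact ENNReal.toReal_lt_of_lt_ofReal h

/-- Sets described fibrewise over `p` are closed under complements and countable unions, taken
separately for each value of `p`, and include both kinds of generators. -/
theorem exists_eq_of_measurableSet_sup_comap {β : Type*} {m : MeasurableSpace X} {p : X → β}
    {A : Set X} (hA : MeasurableSet[m ⊔ MeasurableSpace.comap p ⊤] A) :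
    ∃ C : β → Set X, (∀ b, MeasurableSet[m] (C b)) ∧ A = {x | x ∈ C (p x)} := by
  rw [measurableSet_sup] at hA
  induction A, hA using generateFrom_induction with
  | hC s hs _ =>
    rcases hs with hs | ⟨T, -, rfl⟩
    · exact ⟨fun _ => s, fun _ => hs, rfl⟩
    · refine ⟨fun b => {_x | b ∈ T}, fun b => MeasurableSet.const _, rfl⟩
  | empty => exact ⟨fun _ => ∅, fun _ => MeasurableSet.empty, rfl⟩
  | compl t _ ht =>
    obtain ⟨C, hC, rfl⟩ := ht
    exact ⟨fun b => (C b)ᶜ, fun b => (hC b).compl, rfl⟩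
  | iUnion t _ ht =>
    choose C hC h using ht
    refine ⟨fun b => ⋃ n, C n b, fun b => MeasurableSet.iUnion fun n => hC n b, ?_⟩
    ext x
    simp only [mem_iUnion, mem_ofPred_eq]
    refine exists_congr fun n => ?_
    conv_lhs => rw [h n]
    rfl

/-- A finite family of members of an algebra of sets is refined by a finite partition into members
of the algebra. -/
theorem exists_partition {𝒜 : Set (Set X)} (h𝒜 : IsSetAlgebra 𝒜) (F : Finset (Set X))
    (hF : ∀ s ∈ F, s ∈ 𝒜) :
    ∃ p : X → (F → Prop), (∀ b, p ⁻¹' {b} ∈ 𝒜) ∧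
      generateFrom (F : Set (Set X)) ≤ MeasurableSpace.comap p ⊤ := by
  refine ⟨fun x f => x ∈ f.1, fun b => ?_, ?_⟩
  · classical
    have : (fun (x : X) (f : F) => x ∈ f.1) ⁻¹' {b} =
        ⋂ f ∈ (Finset.univ : Finset F), if b f then f.1 else f.1ᶜ := by
      ext x
      simp only [mem_preimage, mem_singleton_iff, funext_iff, eq_iff_iff, Finset.mem_univ,
        iInter_true, mem_iInter]
      refine forall_congr' fun f => ?_
      by_cases hb : b f <;> simp [hb]
    rw [this]
    refine h𝒜.biInter_mem _ fun f _ => ?_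
    split_ifs
    · exact hF _ f.2
    · exact h𝒜.compl_mem (hF _ f.2)
  · refine generateFrom_le fun s hs => ⟨{b | b ⟨s, hs⟩}, trivial, rfl⟩

theorem setOf_mem_apply_mem {β : Type*} [Finite β] {𝒜 : Set (Set X)} (h𝒜 : IsSetAlgebra 𝒜)
    {p : X → β} (hp : ∀ b, p ⁻¹' {b} ∈ 𝒜) {B : β → Set X} (hB : ∀ b, B b ∈ 𝒜) :
    {x | x ∈ B (p x)} ∈ 𝒜 := by
  have := Fintype.ofFinite β
  have : {x | x ∈ B (p x)} = ⋃ b ∈ (Finset.univ : Finset β), p ⁻¹' {b} ∩ B b := by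
    ext x; simp
  rw [this]
  exact h𝒜.biUnion_mem _ fun b _ => h𝒜.inter_mem (hp b) (hB b)

end Partition

/-! ### Conditional expectations of indicators -/

section CondExp

variable {X : Type*} {m m0 : MeasurableSpace X} {μ : Measure X} [IsFiniteMeasure μ]

theorem integrable_indicator_one {A : Set X} (hA : MeasurableSet[m0] A) :
    Integrable (A.indicator (fun _ => (1 : ℝ))) μ :=
  (integrable_const 1).indicator hA

/-- The set where the conditional expectation of (the indicator of) a well-approximated set is close
to `1` covers most of the set. -/
theorem measureReal_diff_condExp_gt_le (hm : m ≤ m0) {A A' : Set X} (hA : MeasurableSet[m0] A)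
    (hA' : MeasurableSet[m] A') (ε : ℝ) :
    ε * μ.real (A \ {x | 1 - ε < (μ[A.indicator (fun _ => (1 : ℝ)) | m]) x}) ≤
      2 * μ.real (symmDiff A A') := by
  set f : X → ℝ := A.indicator (fun _ => 1) with hf
  set f' : X → ℝ := A'.indicator (fun _ => 1) with hf'
  have hfi : Integrable f μ := integrable_indicator_one hA
  have hfi' : Integrable f' μ := integrable_indicator_one (hm _ hA')
  set g := μ[f | m]
  have hg : Integrable g μ := integrable_condExp
  have hgm : StronglyMeasurable[m] g := stronglyMeasurable_condExp
  have hT : MeasurableSet[m0] (A \ {x | 1 - ε < g x}) :=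
    hA.diff (hm _ (measurableSet_lt (@measurable_const _ _ _ m _) hgm.measurable))
  -- Markov's inequality: on the exceptional set `f = 1` and `g ≤ 1 - ε`.
  have h1 : ε * μ.real (A \ {x | 1 - ε < g x}) ≤ ∫ x, |f x - g x| ∂μ := by
    calc ε * μ.real (A \ {x | 1 - ε < g x}) = ∫ x in A \ {x | 1 - ε < g x}, ε ∂μ := by
          simp [mul_comm]
      _ ≤ ∫ x in A \ {x | 1 - ε < g x}, |f x - g x| ∂μ := by
          refine setIntegral_mono_on (by simp) (hfi.sub hg).abs.integrableOn hT fun x hx => ?_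
          have h2 : g x ≤ 1 - ε := not_lt.1 hx.2
          rw [hf, indicator_of_mem hx.1]
          exact le_trans (by linarith) (le_abs_self _)
      _ ≤ _ := setIntegral_le_integral (hfi.sub hg).abs (ae_of_all _ fun x => abs_nonneg _)
  have h2 : ∫ x, |f x - f' x| ∂μ = μ.real (symmDiff A A') := by
    have : (fun x => |f x - f' x|) = (symmDiff A A').indicator 1 := by
      ext x
      by_cases h1 : x ∈ A <;> by_cases h2 : x ∈ A' <;> simp [hf, hf', h1, h2, mem_symmDiff]
    rw [this, integral_indicator_one (hA.symmDiff (hm _ hA'))]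
  -- Conditional expectation fixes `f'` and is a contraction in the mean.
  have h3 : ∫ x, |f' x - g x| ∂μ ≤ μ.real (symmDiff A A') := by
    have h4 : μ[f - f' | m] =ᵐ[μ] g - f' := by
      refine (condExp_sub hfi hfi' m).trans ?_
      rw [condExp_of_stronglyMeasurable hm (f := f') (stronglyMeasurable_const.indicator hA') hfi']
    calc ∫ x, |f' x - g x| ∂μ = ∫ x, |(μ[f - f' | m]) x| ∂μ := by
          refine integral_congr_ae ?_
          filter_upwards [h4] with x hx
          rw [hx, abs_sub_comm]; rfl
      _ ≤ ∫ x, |(f - f') x| ∂μ := integral_abs_condExp_le _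
      _ = _ := h2
  calc _ ≤ _ := h1
    _ ≤ ∫ x, (|f x - f' x| + |f' x - g x|) ∂μ :=
        integral_mono (hfi.sub hg).abs ((hfi.sub hfi').abs.add (hfi'.sub hg).abs)
          fun x => abs_sub_le _ _ _
    _ = ∫ x, |f x - f' x| ∂μ + ∫ x, |f' x - g x| ∂μ :=
        integral_add (hfi.sub hfi').abs (hfi'.sub hg).abs
    _ ≤ _ := by linarith

/-- Off the positivity set, which belongs to `m`, the indicator and its conditional expectation have
the same integral, and the latter is at most 0. -/
theorem measure_diff_condExp_pos (hm : m ≤ m0) {A : Set X} (hA : MeasurableSet[m0] A) :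
    μ (A \ {x | 0 < (μ[A.indicator (fun _ => (1 : ℝ)) | m]) x}) = 0 := by
  set f : X → ℝ := A.indicator (fun _ => 1) with hf
  have hfi : Integrable f μ := integrable_indicator_one hA
  set T := {x | 0 < (μ[f | m]) x}
  have hT : MeasurableSet[m] T :=
    measurableSet_lt (@measurable_const _ _ _ m _) stronglyMeasurable_condExp.measurable
  have h1 : ∫ x in Tᶜ, f x ∂μ = μ.real (A \ T) := by
    rw [hf, setIntegral_indicator hA, sdiff_eq, inter_comm]; simp
  have h2 : ∫ x in Tᶜ, f x ∂μ ≤ 0 := by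
    rw [← setIntegral_condExp hm hfi hT.compl]
    exact setIntegral_nonpos (hm _ hT.compl) fun x hx => not_lt.1 hx
  rw [h1] at h2
  exact (measureReal_eq_zero_iff).1 (le_antisymm h2 measureReal_nonneg)

/-- A set which is null on `C` has a conditional expectation vanishing on `C`, provided that `C`
does not distinguish the set from its conditional expectation. -/
theorem measure_condExp_pos_inter_eq_zero {A C : Set X} (hC : MeasurableSet[m0] C)
    (hA : MeasurableSet[m0] A)
    (h : ∫ x in C, (A.indicator (fun _ => (1 : ℝ)) x -
      (μ[A.indicator (fun _ => (1 : ℝ)) | m]) x) ∂μ = 0) (h0 : μ (A ∩ C) = 0) :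
    μ ({x | 0 < (μ[A.indicator (fun _ => (1 : ℝ)) | m]) x} ∩ C) = 0 := by
  set f : X → ℝ := A.indicator (fun _ => 1) with hf
  have hfi : Integrable f μ := integrable_indicator_one hA
  have hpos : 0 ≤ᵐ[μ] μ[f | m] :=
    condExp_nonneg (ae_of_all _ fun x => indicator_nonneg (fun _ _ => zero_le_one) x)
  rw [integral_sub hfi.integrableOn integrable_condExp.integrableOn, hf,
    setIntegral_indicator hA, inter_comm C] at h
  rw [Measure.restrict_eq_zero.2 h0, integral_zero_measure, zero_sub, neg_eq_zero,
    setIntegral_eq_zero_iff_of_nonneg_ae (ae_restrict_of_ae hpos)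
      integrable_condExp.integrableOn] at h
  have h3 := (ae_restrict_iff' hC).1 h
  refine measure_mono_null ?_ (ae_iff.1 h3)
  rintro x ⟨hx, hxC⟩
  simp only [mem_ofPred_eq, Classical.not_imp]
  exact ⟨hxC, ne_of_gt hx⟩

end CondExp

/-! ### Removal for conditionally independent algebras -/

section Removal

variable {X : Type*} {V : Type*}

/-- The algebra of sets generated by the members of the algebras `𝒜 J` with `J ∈ 𝓓` and
`J ⊆ S`. -/
def lvl (𝒜 : Finset V → Set (Set X)) (𝓓 : Finset (Finset V)) (S : Finset V) : Set (Set X) :=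
  generateSetAlgebra {A | ∃ J ∈ 𝓓, J ⊆ S ∧ A ∈ 𝒜 J}

variable {𝒜 : Finset V → Set (Set X)} {𝓓 𝓓' : Finset (Finset V)} {S T : Finset V}

theorem isSetAlgebra_lvl : IsSetAlgebra (lvl 𝒜 𝓓 S) := isSetAlgebra_generateSetAlgebra

theorem lvl_subset (h : ∀ J ∈ 𝓓, J ⊆ S → J ∈ 𝓓' ∧ J ⊆ T) : lvl 𝒜 𝓓 S ⊆ lvl 𝒜 𝓓' T :=
  generateSetAlgebra_mono fun _ ⟨J, hJ, hJS, hA⟩ => ⟨J, (h J hJ hJS).1, (h J hJ hJS).2, hA⟩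

theorem mem_lvl {J : Finset V} (hJ : J ∈ 𝓓) (hJS : J ⊆ S) {A : Set X} (hA : A ∈ 𝒜 J) :
    A ∈ lvl 𝒜 𝓓 S :=
  self_subset_generateSetAlgebra ⟨J, hJ, hJS, hA⟩

theorem lvl_subset_of_mono (h𝒜 : ∀ S, IsSetAlgebra (𝒜 S)) (hmono : Monotone 𝒜) :
    lvl 𝒜 𝓓 S ⊆ 𝒜 S :=
  (h𝒜 S).generateSetAlgebra_subset fun _ ⟨_, _, hJS, hA⟩ => hmono hJS hA

theorem mem_of_mem_lvl_empty {A : Set X} (hA : MeasurableSet[generateFrom (lvl 𝒜 ∅ S)] A) :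
    A = ∅ ∨ A = univ := by
  have : generateFrom (lvl 𝒜 ∅ S) = ⊥ := by
    rw [lvl, generateFrom_generateSetAlgebra_eq]
    simp
  rw [this] at hA
  exact measurableSet_bot_iff.1 hA

/-- A member of the algebra at a level involves only finitely many sets of each of the generating
algebras. -/
theorem exists_finset_of_mem_lvl [DecidableEq V] (J : Finset V) {A : Set X}
    (hA : A ∈ lvl 𝒜 𝓓 S) :
    ∃ F : Finset (Set X), (∀ s ∈ F, s ∈ 𝒜 J) ∧
      MeasurableSet[generateFrom (lvl 𝒜 (𝓓.erase J) S) ⊔ generateFrom (F : Set (Set X))] A := by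
  classical
  induction hA with
  | base s hs =>
    obtain ⟨K, hK, hKS, hs⟩ := hs
    by_cases h : K = J
    · subst h
      refine ⟨{s}, by simpa using hs, ?_⟩
      exact le_sup_right (a := generateFrom (lvl 𝒜 (𝓓.erase K) S)) _
        (measurableSet_generateFrom (by simp))
    · refine ⟨∅, by simp, ?_⟩
      exact le_sup_left (b := generateFrom ((∅ : Finset (Set X)) : Set (Set X))) _
        (measurableSet_generateFrom (mem_lvl (Finset.mem_erase.2 ⟨h, hK⟩) hKS hs))
  | empty => exact ⟨∅, by simp, @MeasurableSet.empty _ (_ ⊔ _)⟩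
  | compl s _ hs =>
    obtain ⟨F, hF, hs⟩ := hs
    exact ⟨F, hF, hs.compl⟩
  | union s t _ _ hs ht =>
    obtain ⟨F, hF, hs⟩ := hs
    obtain ⟨F', hF', ht⟩ := ht
    refine ⟨F ∪ F', fun s hs => (Finset.mem_union.1 hs).elim (hF s) (hF' s), ?_⟩
    refine MeasurableSet.union ?_ ?_
    · refine (sup_le_sup le_rfl (generateFrom_mono ?_) : _ ≤ _) _ hs
      simp
    · refine (sup_le_sup le_rfl (generateFrom_mono ?_) : _ ≤ _) _ ht
      simp

variable {m0 : MeasurableSpace X} {μ : Measure X} [IsFiniteMeasure μ]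

/-- Approximation of sets of level `𝓓` by sets that depend on the top index `J` only through a
finite partition. -/
theorem exists_partition_approx [DecidableEq V] (h𝒜 : ∀ S, IsSetAlgebra (𝒜 S))
    (hmono : Monotone 𝒜) (hm : ∀ S, generateFrom (𝒜 S) ≤ m0) (J : Finset V)
    {ι : Type} [Fintype ι] {S : ι → Finset V} {A : ι → Set X}
    (hA : ∀ i, MeasurableSet[generateFrom (lvl 𝒜 𝓓 (S i))] (A i)) {δ ε : ℝ} (hδ : 0 < δ)
    (hε : 0 < ε) :
    ∃ (F : Finset (Set X)) (p : X → (F → Prop)) (C : ι → (F → Prop) → Set X),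
      (∀ b, p ⁻¹' {b} ∈ 𝒜 J) ∧
      (∀ i b, MeasurableSet[generateFrom (lvl 𝒜 (𝓓.erase J) (S i))] (C i b)) ∧
      (∀ i, μ.real (A i \ {x | x ∈ C i (p x)}) < δ) ∧
      (∀ i, ¬ J ⊆ S i → ∀ b, C i b = A i) ∧
      (∀ i, J ⊆ S i → ∀ x, x ∈ C i (p x) → 1 - ε < (μ[(A i).indicator (fun _ => (1 : ℝ)) |
        generateFrom (lvl 𝒜 (𝓓.erase J) (S i)) ⊔ MeasurableSpace.comap p ⊤]) x) := by
  classical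
  have hle : ∀ (𝓔 : Finset (Finset V)) S, generateFrom (lvl 𝒜 𝓔 S) ≤ generateFrom (𝒜 S) :=
    fun 𝓔 S => generateFrom_mono (lvl_subset_of_mono h𝒜 hmono)
  -- `measureReal_diff_condExp_gt_le` doubles this error and divides it by `ε`, which leaves `δ`.
  have hη : 0 < δ * ε / 2 := by positivity
  choose A' hA' hAA' using fun i => exists_symmDiff_lt μ isSetAlgebra_lvl
    ((hle 𝓓 (S i)).trans (hm _)) (hA i) hη
  choose F hF hFA using fun i => exists_finset_of_mem_lvl J (hA' i)
  obtain ⟨p, hp, hpF⟩ := exists_partition (h𝒜 J) (Finset.univ.biUnion F) (by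
    intro s hs
    obtain ⟨i, -, hi⟩ := Finset.mem_biUnion.1 hs
    exact hF i s hi)
  have hA'' : ∀ i, MeasurableSet[generateFrom (lvl 𝒜 (𝓓.erase J) (S i)) ⊔
      MeasurableSpace.comap p ⊤] (A' i) := fun i => by
    refine sup_le_sup le_rfl (le_trans (generateFrom_mono ?_) hpF) _ (hFA i)
    exact Finset.coe_subset.2 (Finset.subset_biUnion_of_mem F (Finset.mem_univ i))
  have hpm : MeasurableSpace.comap p ⊤ ≤ generateFrom (𝒜 J) := by
    rintro _ ⟨T, -, rfl⟩
    rw [← biUnion_preimage_singleton]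
    exact MeasurableSet.biUnion (to_countable T) fun b _ => measurableSet_generateFrom (hp b)
  have key : ∀ i, ∃ C : (↥(Finset.biUnion Finset.univ F) → Prop) → Set X,
      (∀ b, MeasurableSet[generateFrom (lvl 𝒜 (𝓓.erase J) (S i))] (C b)) ∧
      μ.real (A i \ {x | x ∈ C (p x)}) < δ ∧ (¬ J ⊆ S i → ∀ b, C b = A i) ∧
      (J ⊆ S i → ∀ x, x ∈ C (p x) → 1 - ε < (μ[(A i).indicator (fun _ => (1 : ℝ)) |
        generateFrom (lvl 𝒜 (𝓓.erase J) (S i)) ⊔ MeasurableSpace.comap p ⊤]) x) := by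
    intro i
    by_cases hJ : J ⊆ S i
    · set m := generateFrom (lvl 𝒜 (𝓓.erase J) (S i)) ⊔ MeasurableSpace.comap p ⊤
      have hm0 : m ≤ m0 := sup_le ((hle _ _).trans (hm _)) (hpm.trans (hm J))
      -- The approximant is not `A' i` but the set where the conditional density of `A i` exceeds `1
      -- - ε`; this pointwise bound is what later forces null intersections.
      obtain ⟨C, hC, hCeq⟩ := exists_eq_of_measurableSet_sup_comap (p := p)
        (m := generateFrom (lvl 𝒜 (𝓓.erase J) (S i)))
        (A := {x | 1 - ε < (μ[(A i).indicator (fun _ => (1 : ℝ)) | m]) x})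
        (measurableSet_lt (@measurable_const _ _ _ m _) stronglyMeasurable_condExp.measurable)
      refine ⟨C, hC, ?_, fun h => absurd hJ h, fun _ x hx => ?_⟩
      · rw [← hCeq]
        have := measureReal_diff_condExp_gt_le hm0 (((hle _ _).trans (hm _)) _ (hA i))
          (hA'' i) ε (μ := μ)
        have h2 := hAA' i
        by_contra! h3
        nlinarith [mul_le_mul_of_nonneg_left h3 hε.le]
      · have : x ∈ {x | x ∈ C (p x)} := hx
        rwa [← hCeq] at this
    -- When `J` is not inside `S i`, erasing it does not change the level, so `A i` itself serves.
    · refine ⟨fun _ => A i, fun b => ?_, by simpa using hδ, fun _ _ => rfl, fun h => absurd h hJ⟩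
      refine generateFrom_mono (lvl_subset fun K hK hKS => ⟨Finset.mem_erase.2 ⟨?_, hK⟩, hKS⟩) _
        (hA i)
      rintro rfl
      exact hJ hKS
  choose C h1 h2 h3 h4 using key
  exact ⟨_, p, C, hp, h1, h2, h3, h4⟩

variable [Fintype V]

/-- For every `S` and every down-closed family `𝓓`, the σ-algebra generated by `𝒜 S` and the one
generated by the `𝒜 J`, `J ∈ 𝓓`, are conditionally independent over the one generated by
the `𝒜 J`, `J ∈ 𝓓`, `J ⊆ S`. -/
def CondIndep (μ : Measure X) (𝒜 : Finset V → Set (Set X)) : Prop :=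
  ∀ 𝓓 : Finset (Finset V), IsLowerSet (𝓓 : Set (Finset V)) → ∀ (S : Finset V) (f : X → ℝ),
    Integrable f μ → StronglyMeasurable[generateFrom (𝒜 S)] f →
    (∀ C, MeasurableSet[generateFrom (lvl 𝒜 𝓓 S)] C → ∫ x in C, f x ∂μ = 0) →
    ∀ G, MeasurableSet[generateFrom (lvl 𝒜 𝓓 Finset.univ)] G → ∫ x in G, f x ∂μ = 0

/-- A set `D` at level `𝓓`, intersected with a member of `𝒜 J`, meets a set `A` of `𝒜 S` with the
density that is predicted by the conditional expectation of `A` over the part of the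
information that lies inside `S`. -/
theorem setIntegral_condExp_eq_of_condIndep (hm : ∀ S, generateFrom (𝒜 S) ≤ m0)
    (hind : CondIndep μ 𝒜) (h𝓓 : IsLowerSet (𝓓 : Set (Finset V))) {m : MeasurableSpace X}
    (hmS : m ≤ generateFrom (𝒜 S)) (hm𝓓 : generateFrom (lvl 𝒜 𝓓 S) ≤ m)
    {A a D : Set X} (hA : MeasurableSet[generateFrom (𝒜 S)] A) (ha : MeasurableSet[m] a)
    (hD : MeasurableSet[generateFrom (lvl 𝒜 𝓓 Finset.univ)] D) :
    ∫ x in D ∩ a, (A.indicator (fun _ => (1 : ℝ)) x -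
      (μ[A.indicator (fun _ => (1 : ℝ)) | m]) x) ∂μ = 0 := by
  have hm0 : m ≤ m0 := hmS.trans (hm S)
  have hAi : Integrable (A.indicator (fun _ => (1 : ℝ))) μ := integrable_indicator_one (hm S _ hA)
  set g : X → ℝ := fun x => A.indicator (fun _ => (1 : ℝ)) x -
      (μ[A.indicator (fun _ => (1 : ℝ)) | m]) x with hg
  have hgi : Integrable g μ := hAi.sub integrable_condExp
  have ha0 : MeasurableSet[m0] a := hm0 _ ha
  have key := hind 𝓓 h𝓓 S (a.indicator g) (hgi.indicator ha0) ?_ ?_ D hD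
  · rwa [setIntegral_indicator ha0] at key
  · refine StronglyMeasurable.indicator ?_ (hmS _ ha)
    exact (stronglyMeasurable_const.indicator hA).sub (stronglyMeasurable_condExp.mono hmS)
  · intro C hC
    rw [setIntegral_indicator ha0, hg, integral_sub hAi.integrableOn
      integrable_condExp.integrableOn, setIntegral_condExp hm0 hAi ((hm𝓓 _ hC).inter ha), sub_self]


/-- If the sets `A i` have a null intersection, then so do the sets that approximate them. -/
theorem measure_iInter_approx_eq_zero [DecidableEq V] (h𝒜 : ∀ S, IsSetAlgebra (𝒜 S))
    (hmono : Monotone 𝒜) (hm : ∀ S, generateFrom (𝒜 S) ≤ m0) (hind : CondIndep μ 𝒜)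
    {J : Finset V} (h𝓓 : IsLowerSet ((𝓓.erase J : Finset (Finset V)) : Set (Finset V)))
    {ι : Type} [Fintype ι] {S : ι → Finset V} {A : ι → Set X}
    (hA : ∀ i, MeasurableSet[generateFrom (𝒜 (S i))] (A i))
    (h0 : μ (⋂ i, A i) = 0) {ε : ℝ} (hε : Fintype.card ι * ε < 1)
    {β : Type*} [Finite β] {p : X → β} {C : ι → β → Set X} (hp : ∀ b, p ⁻¹' {b} ∈ 𝒜 J)
    (hC : ∀ i b, MeasurableSet[generateFrom (lvl 𝒜 (𝓓.erase J) (S i))] (C i b))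
    (hCA : ∀ i, ¬ J ⊆ S i → ∀ b, C i b = A i)
    (hCε : ∀ i, J ⊆ S i → ∀ x, x ∈ C i (p x) → 1 - ε < (μ[(A i).indicator (fun _ => (1 : ℝ)) |
        generateFrom (lvl 𝒜 (𝓓.erase J) (S i)) ⊔ MeasurableSpace.comap p ⊤]) x)
    (hε0 : 0 ≤ ε) (b : β) :
    μ (p ⁻¹' {b} ∩ ⋂ i, C i b) = 0 := by
  have hle : ∀ (𝓔 : Finset (Finset V)) S, generateFrom (lvl 𝒜 𝓔 S) ≤ generateFrom (𝒜 S) :=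
    fun 𝓔 S => generateFrom_mono (lvl_subset_of_mono h𝒜 hmono)
  have hpm : MeasurableSpace.comap p ⊤ ≤ generateFrom (𝒜 J) := by
    rintro _ ⟨T, -, rfl⟩
    rw [← biUnion_preimage_singleton]
    exact MeasurableSet.biUnion (to_countable T) fun b _ => measurableSet_generateFrom (hp b)
  have hD : MeasurableSet[generateFrom (lvl 𝒜 (𝓓.erase J) Finset.univ)] (⋂ i, C i b) :=
    MeasurableSet.iInter fun i => generateFrom_mono
      (lvl_subset fun K hK _ => ⟨hK, Finset.subset_univ K⟩) _ (hC i b)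
  rw [inter_comm]
  set D := (⋂ i, C i b) ∩ p ⁻¹' {b} with hDdef
  have hDm : MeasurableSet[m0] D :=
    (((hle _ _).trans (hm _)) _ hD).inter (hm J _ (measurableSet_generateFrom (hp b)))
  have hdiff : ∀ i, μ.real (D \ A i) ≤ ε * μ.real D := by
    intro i
    by_cases hJ : J ⊆ S i
    · set m := generateFrom (lvl 𝒜 (𝓓.erase J) (S i)) ⊔ MeasurableSpace.comap p ⊤
      have hmS : m ≤ generateFrom (𝒜 (S i)) :=
        sup_le (hle _ _) (hpm.trans (generateFrom_mono (hmono hJ)))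
      have hAm : MeasurableSet[m0] (A i) := hm _ _ (hA i)
      -- `D` need not be `m`-measurable, because the other `C j b` may involve coordinates off `S
      -- i`; conditional independence still equates the two integrals over `D`.
      have h1 := setIntegral_condExp_eq_of_condIndep (a := p ⁻¹' {b}) hm hind h𝓓 hmS le_sup_left
        (hA i) (le_sup_right (a := generateFrom (lvl 𝒜 (𝓓.erase J) (S i))) _
          ⟨{b}, trivial, rfl⟩) hD
      rw [← hDdef, integral_sub (integrable_indicator_one hAm).integrableOn
        integrable_condExp.integrableOn, setIntegral_indicator hAm, sub_eq_zero] at h1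
      have h2 : ∫ x in D, (1 - ε) ∂μ ≤ ∫ x in D, (μ[(A i).indicator (fun _ => (1 : ℝ)) | m]) x ∂μ := by
        refine setIntegral_mono_on (by simp) integrable_condExp.integrableOn hDm fun x hx => ?_
        refine (hCε i hJ x ?_).le
        have : p x = b := hx.2
        rw [this]
        exact mem_iInter.1 hx.1 i
      rw [← h1] at h2
      simp only [integral_const, smul_eq_mul, mul_one, measureReal_restrict_apply_univ] at h2
      have h3 := measureReal_inter_add_sdiff (μ := μ) (s := D) hAm
      linarith
    · have : D \ A i = ∅ := by
        rw [sdiff_eq_empty, ← hCA i hJ b]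
        exact inter_subset_left.trans (iInter_subset _ i)
      rw [this, measureReal_empty]
      positivity
  have hsub : D ⊆ (⋂ i, A i) ∪ ⋃ i ∈ (Finset.univ : Finset ι), D \ A i := by
    intro x hx
    by_cases h : ∀ i, x ∈ A i
    · exact Or.inl (mem_iInter.2 h)
    · push Not at h
      obtain ⟨i, hi⟩ := h
      exact Or.inr (mem_biUnion (Finset.mem_univ i) ⟨hx, hi⟩)
  -- The `A i` miss at most the fraction `card ι * ε < 1` of `D` altogether, and their intersection
  -- is null, so `D` is null.
  have h4 : μ.real D ≤ Fintype.card ι * (ε * μ.real D) := by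
    calc μ.real D ≤ μ.real ((⋂ i, A i) ∪ ⋃ i ∈ (Finset.univ : Finset ι), D \ A i) :=
          measureReal_mono hsub
      _ ≤ μ.real (⋂ i, A i) + μ.real (⋃ i ∈ (Finset.univ : Finset ι), D \ A i) :=
          measureReal_union_le _ _
      _ ≤ 0 + ∑ i, μ.real (D \ A i) := by
          refine add_le_add ?_ (measureReal_biUnion_finset_le _ _)
          rw [(measureReal_eq_zero_iff).2 h0]
      _ ≤ 0 + ∑ i : ι, ε * μ.real D := by
          gcongr with i
          exact hdiff i
      _ = _ := by simp
  have h5 : μ.real D = 0 := by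
    by_contra h
    have h6 : 0 < μ.real D := lt_of_le_of_ne measureReal_nonneg (Ne.symm h)
    nlinarith
  exact (measureReal_eq_zero_iff).1 h5

/-- Removal for conditionally independent algebras. -/
theorem exists_removal [DecidableEq V] [NeZero μ] (h𝒜 : ∀ S, IsSetAlgebra (𝒜 S))
    (hmono : Monotone 𝒜) (hm : ∀ S, generateFrom (𝒜 S) ≤ m0) (hind : CondIndep μ 𝒜)
    (h𝓓 : IsLowerSet (𝓓 : Set (Finset V))) {ι : Type} [Fintype ι] {S : ι → Finset V}
    {A : ι → Set X} (hA : ∀ i, MeasurableSet[generateFrom (lvl 𝒜 𝓓 (S i))] (A i))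
    (h0 : μ (⋂ i, A i) = 0) {δ : ℝ} (hδ : 0 < δ) :
    ∃ B : ι → Set X, (∀ i, B i ∈ lvl 𝒜 𝓓 (S i)) ∧ (∀ i, μ.real (A i \ B i) < δ) ∧
      ⋂ i, B i = ∅ := by
  classical
  have hle : ∀ (𝓔 : Finset (Finset V)) S, generateFrom (lvl 𝒜 𝓔 S) ≤ generateFrom (𝒜 S) :=
    fun 𝓔 S => generateFrom_mono (lvl_subset_of_mono h𝒜 hmono)
  induction hn : 𝓓.card generalizing 𝓓 ι δ with
  | zero =>
    obtain rfl := Finset.card_eq_zero.1 hn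
    -- Over the empty family each `A i` is empty or everything; as `μ ≠ 0`, a null intersection is
    -- already empty.
    refine ⟨A, fun i => ?_, fun i => by simpa using hδ, ?_⟩
    · rcases mem_of_mem_lvl_empty (hA i) with h | h <;> rw [h]
      · exact isSetAlgebra_lvl.empty_mem
      · exact isSetAlgebra_lvl.univ_mem
    · by_contra h
      have : ⋂ i, A i = univ := iInter_eq_univ.2 fun i =>
        (mem_of_mem_lvl_empty (hA i)).resolve_left fun h' =>
          h (subset_empty_iff.1 (h' ▸ iInter_subset A i))
      rw [this] at h0
      exact NeZero.ne μ (Measure.measure_univ_eq_zero.1 h0)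
  | succ N ih =>
    -- Maximality keeps the family down-closed after `J` is erased.
    obtain ⟨J, hJ⟩ := 𝓓.exists_maximal (Finset.card_pos.1 (by omega))
    have hJ𝓓 : J ∈ 𝓓 := hJ.prop
    have hcard : (𝓓.erase J).card = N := by rw [Finset.card_erase_of_mem hJ𝓓, hn]; rfl
    have h𝓓' : IsLowerSet ((𝓓.erase J : Finset (Finset V)) : Set (Finset V)) := by
      intro K K' hKK' hK
      rw [Finset.mem_coe, Finset.mem_erase] at hK ⊢
      refine ⟨?_, h𝓓 hKK' hK.2⟩
      rintro rfl
      exact hK.1 (le_antisymm (hJ.le_of_ge hK.2 hKK') hKK')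
    have hne : ∀ i, ¬ J ⊆ S i → lvl 𝒜 𝓓 (S i) ⊆ lvl 𝒜 (𝓓.erase J) (S i) := fun i hi =>
      lvl_subset fun K hK hKS => ⟨Finset.mem_erase.2 ⟨fun h => hi (h ▸ hKS), hK⟩, hKS⟩
    have hsub : ∀ T, lvl 𝒜 (𝓓.erase J) T ⊆ lvl 𝒜 𝓓 T := fun T =>
      lvl_subset fun K hK hKS => ⟨Finset.mem_of_mem_erase hK, hKS⟩
    -- Some `S i` must contain `J` in order to absorb the additional set `B₀` below; otherwise the
    -- levels do not see `J`.
    by_cases hex : ∃ i, J ⊆ S i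
    swap
    · push Not at hex
      obtain ⟨B, hB, hB', hB''⟩ := ih h𝓓' (fun i => generateFrom_mono (hne i (hex i)) _ (hA i))
        h0 hδ hcard
      exact ⟨B, fun i => hsub _ (hB i), hB', hB''⟩
    obtain ⟨i₀, hi₀⟩ := hex
    set ε : ℝ := 1 / (Fintype.card ι + 1) with hε
    have hε0 : 0 < ε := by positivity
    have hε1 : Fintype.card ι * ε < 1 := by
      rw [hε, mul_one_div, div_lt_one (by positivity)]; linarith
    obtain ⟨F, p, C, hp, hC, hCδ, hCA, hCε⟩ := exists_partition_approx (μ := μ) h𝒜 hmono hm J hA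
      (half_pos hδ) hε0
    have hnull := measure_iInter_approx_eq_zero h𝒜 hmono hm hind h𝓓' (fun i => hle _ _ _ (hA i))
      h0 hε1 hp hC hCA hCε hε0.le
    -- Half of `δ` pays for passing from `A i` to the `C i b`; the other half is shared by two
    -- errors in each cell.
    set γ : ℝ := δ / 2 / (2 * Fintype.card (F → Prop)) with hγ
    have hcpos : (0 : ℝ) < Fintype.card (F → Prop) := by
      exact_mod_cast Fintype.card_pos
    have hγ0 : 0 < γ := by positivity
    have step : ∀ b, ∃ (B₀ : Set X) (B : ι → Set X), B₀ ∈ lvl 𝒜 (𝓓.erase J) J ∧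
        (∀ i, B i ∈ lvl 𝒜 (𝓓.erase J) (S i)) ∧ μ.real (p ⁻¹' {b} \ B₀) < γ ∧
        (∀ i, μ.real (C i b \ B i) < γ) ∧ B₀ ∩ ⋂ i, B i = ∅ := by
      intro b
      set mJ := generateFrom (lvl 𝒜 (𝓓.erase J) J)
      set a := {x | 0 < (μ[(p ⁻¹' {b}).indicator (fun _ => (1 : ℝ)) | mJ]) x}
      have hmJ : mJ ≤ m0 := (hle _ _).trans (hm _)
      have hpb : MeasurableSet[generateFrom (𝒜 J)] (p ⁻¹' {b}) := measurableSet_generateFrom (hp b)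
      have hD : MeasurableSet[generateFrom (lvl 𝒜 (𝓓.erase J) Finset.univ)] (⋂ i, C i b) :=
        MeasurableSet.iInter fun i => generateFrom_mono
          (lvl_subset fun K hK _ => ⟨hK, Finset.subset_univ K⟩) _ (hC i b)
      have ha : MeasurableSet[mJ] a :=
        measurableSet_lt (@measurable_const _ _ _ mJ _) stronglyMeasurable_condExp.measurable
      have h1 := setIntegral_condExp_eq_of_condIndep (a := univ) hm hind h𝓓' (hle _ _) le_rfl
        hpb MeasurableSet.univ hD
      rw [inter_univ] at h1
      have h2 := measure_condExp_pos_inter_eq_zero (((hle _ _).trans (hm _)) _ hD) (hm _ _ hpb)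
        h1 (hnull b)
      -- The cell itself is not of the lower level. The support `a` of its conditional expectation
      -- is, contains the cell up to a null set, and still has null intersection with the `C i b`;
      -- it enters as the additional index `none`.
      obtain ⟨B, hB, hB', hB''⟩ := ih (ι := Option ι) (S := fun o => o.elim J S)
        (A := fun o => o.elim a fun i => C i b) h𝓓' (by rintro (_ | i); exacts [ha, hC i b])
        (by rwa [iInter_option]) hγ0 hcard
      refine ⟨B none, fun i => B (some i), hB none, fun i => hB (some i), ?_,
        fun i => hB' (some i), by rwa [iInter_option] at hB''⟩
      calc μ.real (p ⁻¹' {b} \ B none) ≤ μ.real ((p ⁻¹' {b} \ a) ∪ (a \ B none)) :=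
            measureReal_mono fun x hx => by
              by_cases hxa : x ∈ a
              · exact Or.inr ⟨hxa, hx.2⟩
              · exact Or.inl ⟨hx.1, hxa⟩
        _ ≤ μ.real (p ⁻¹' {b} \ a) + μ.real (a \ B none) := measureReal_union_le _ _
        _ < γ := by
            rw [(measureReal_eq_zero_iff).2 (measure_diff_condExp_pos hmJ (hm _ _ hpb)), zero_add]
            exact hB' none
    choose B₀ B hB₀ hB hB₀γ hBγ hempty using step
    have hsum : ∀ i, ∑ b, (μ.real (p ⁻¹' {b} \ B₀ b) + μ.real (C i b \ B b i)) ≤ δ / 2 := by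
      intro i
      calc ∑ b, (μ.real (p ⁻¹' {b} \ B₀ b) + μ.real (C i b \ B b i)) ≤
            ∑ b : F → Prop, (γ + γ) :=
            Finset.sum_le_sum fun b _ => add_le_add (hB₀γ b).le (hBγ b i).le
        _ = δ / 2 := by
            rw [Finset.sum_const, Finset.card_univ, nsmul_eq_mul, hγ]
            field_simp
            ring
    -- If `J ⊆ S i`, the cells are available at level `S i` and gluing is possible. Otherwise they
    -- are not, but then `C i b = A i` for every `b`, so intersecting over all `b` loses little of
    -- `A i`.
    refine ⟨fun i => if J ⊆ S i then {x | x ∈ B₀ (p x) ∩ B (p x) i} else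
      ⋂ b ∈ (Finset.univ : Finset (F → Prop)), B b i, fun i => ?_, fun i => ?_, ?_⟩
    · dsimp only
      split_ifs with hi
      · refine setOf_mem_apply_mem isSetAlgebra_lvl (p := p) (B := fun b => B₀ b ∩ B b i)
          (fun b => mem_lvl hJ𝓓 hi (hp b)) fun b => isSetAlgebra_lvl.inter_mem ?_ (hsub _ (hB b i))
        exact lvl_subset (fun K hK hKJ => ⟨Finset.mem_of_mem_erase hK, hKJ.trans hi⟩) (hB₀ b)
      · exact isSetAlgebra_lvl.biInter_mem _ fun b _ => hsub _ (hB b i)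
    · refine lt_of_le_of_lt (b := μ.real (A i \ {x | x ∈ C i (p x)}) + δ / 2) ?_
        (by linarith [hCδ i])
      refine le_trans ?_ (add_le_add le_rfl (hsum i))
      refine le_trans (measureReal_mono (s₂ := (A i \ {x | x ∈ C i (p x)}) ∪
        ⋃ b ∈ (Finset.univ : Finset (F → Prop)), ((p ⁻¹' {b} \ B₀ b) ∪ (C i b \ B b i))) ?_)
        ((measureReal_union_le _ _).trans (add_le_add le_rfl
          ((measureReal_biUnion_finset_le _ _).trans
            (Finset.sum_le_sum fun b _ => measureReal_union_le _ _))))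
      rintro x ⟨hxA, hx⟩
      by_cases hxC : x ∈ C i (p x)
      · refine Or.inr ?_
        simp only [Finset.mem_univ, iUnion_true, mem_iUnion]
        dsimp only at hx
        split_ifs at hx with hi
        · refine ⟨p x, ?_⟩
          by_cases h : x ∈ B₀ (p x)
          · exact Or.inr ⟨hxC, fun h' => hx ⟨h, h'⟩⟩
          · exact Or.inl ⟨rfl, h⟩
        · simp only [Finset.mem_univ, iInter_true, mem_iInter, not_forall] at hx
          obtain ⟨b, hb⟩ := hx
          exact ⟨b, Or.inr ⟨(hCA i hi b).symm ▸ hxA, hb⟩⟩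
      · exact Or.inl ⟨hxA, hxC⟩
    · rw [eq_empty_iff_forall_notMem]
      intro x hx
      rw [mem_iInter] at hx
      have hxi : ∀ i, x ∈ B (p x) i := fun i => by
        have := hx i
        split_ifs at this with hi
        · exact this.2
        · simp only [Finset.mem_univ, iInter_true, mem_iInter] at this
          exact this (p x)
      have hx0 : x ∈ B₀ (p x) := by
        have := hx i₀
        rw [if_pos hi₀] at this
        exact this.1
      exact (eq_empty_iff_forall_notMem.1 (hempty (p x))) x ⟨hx0, mem_iInter.2 hxi⟩

end Removal

/-! ### Syntax: renaming, conjunctions, blocks of quantifiers -/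

section Formulas

variable {L : FirstOrder.Language.{u, v}}

/-- Renaming of the free variables of a formula. -/
def AMLFormula.relabel : {α : Type} → AMLFormula L α → {β : Type} → (α → β) → AMLFormula L β
  | _, .equal t₁ t₂, _, g => .equal (t₁.relabel g) (t₂.relabel g)
  | _, .rel R ts, _, g => .rel R fun i => (ts i).relabel g
  | _, .not φ, _, g => .not (φ.relabel g)
  | _, .and φ ψ, _, g => .and (φ.relabel g) (ψ.relabel g)
  | _, .ex φ, _, g => .ex (φ.relabel (Sum.map g id))
  | _, .all φ, _, g => .all (φ.relabel (Sum.map g id))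
  | _, .measLT k hk q φ, _, g => .measLT k hk q (φ.relabel (Sum.map g id))
  | _, .measLE k hk q φ, _, g => .measLE k hk q (φ.relabel (Sum.map g id))

variable {M : Type w} [L.Structure M] (𝔐 : Quasistructure L M)

theorem Quasistructure.realize_relabel {α : Type} (φ : AMLFormula L α) {β : Type} (g : α → β)
    (s : β → M) : 𝔐.Realize (φ.relabel g) s ↔ 𝔐.Realize φ (s ∘ g) := by
  induction φ generalizing β with
  | equal t₁ t₂ => simp [AMLFormula.relabel, Quasistructure.Realize]
  | rel R ts => simp [AMLFormula.relabel, Quasistructure.Realize]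
  | not φ ih => simp [AMLFormula.relabel, Quasistructure.Realize, ih]
  | and φ ψ ih₁ ih₂ => simp [AMLFormula.relabel, Quasistructure.Realize, ih₁, ih₂]
  | ex φ ih => simp [AMLFormula.relabel, Quasistructure.Realize, ih, Sum.elim_comp_map]
  | all φ ih => simp [AMLFormula.relabel, Quasistructure.Realize, ih, Sum.elim_comp_map]
  | measLT k hk q φ ih =>
    simp [AMLFormula.relabel, Quasistructure.Realize, ih, Sum.elim_comp_map]
  | measLE k hk q φ ih =>
    simp [AMLFormula.relabel, Quasistructure.Realize, ih, Sum.elim_comp_map]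

/-- A formula that holds everywhere. -/
def AMLFormula.top {α : Type} : AMLFormula L α :=
  .all (.equal (.var (Sum.inr ())) (.var (Sum.inr ())))

theorem Quasistructure.realize_top {α : Type} (s : α → M) : 𝔐.Realize .top s := by
  simp [AMLFormula.top, Quasistructure.Realize]

/-- The conjunction of a list of formulas. -/
def AMLFormula.conj {α : Type} (l : List (AMLFormula L α)) : AMLFormula L α :=
  l.foldr .and .top

theorem Quasistructure.realize_conj {α : Type} (l : List (AMLFormula L α)) (s : α → M) :
    𝔐.Realize (.conj l) s ↔ ∀ φ ∈ l, 𝔐.Realize φ s := by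
  induction l with
  | nil => simpa [AMLFormula.conj] using 𝔐.realize_top s
  | cons φ l ih =>
    rw [List.forall_mem_cons, ← ih]
    simp [AMLFormula.conj, Quasistructure.Realize]

/-- Existential quantification over a tuple of variables. -/
def AMLFormula.exs {α : Type} : {p : ℕ} → AMLFormula L (α ⊕ Fin p) → AMLFormula L α
  | 0, φ => φ.relabel (Sum.elim id Fin.elim0)
  | _ + 1, φ => AMLFormula.exs (.ex (φ.relabel (Sum.elim (fun a => .inl (.inl a))
      (Fin.lastCases (.inr ()) fun i => .inl (.inr i)))))

theorem Quasistructure.realize_exs {α : Type} {p : ℕ} (φ : AMLFormula L (α ⊕ Fin p)) (s : α → M) :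
    𝔐.Realize φ.exs s ↔ ∃ c : Fin p → M, 𝔐.Realize φ (Sum.elim s c) := by
  induction p with
  | zero =>
    have h : ∀ c : Fin 0 → M, s ∘ Sum.elim id Fin.elim0 = Sum.elim s c := fun c => by
      ext (a | i)
      · rfl
      · exact i.elim0
    rw [AMLFormula.exs, realize_relabel]
    exact ⟨fun h' => ⟨Fin.elim0, h _ ▸ h'⟩, fun ⟨c, h'⟩ => h c ▸ h'⟩
  | succ p ih =>
    have h : ∀ (c : Fin p → M) (a : M), Sum.elim (Sum.elim s c) (fun _ : Unit => a) ∘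
        Sum.elim (fun a => .inl (.inl a)) (Fin.lastCases (.inr ()) fun i => .inl (.inr i)) =
        Sum.elim s (Fin.snoc c a) := fun c a => by
      ext (b | i)
      · rfl
      · induction i using Fin.lastCases <;> simp
    rw [AMLFormula.exs, ih]
    simp only [Quasistructure.Realize, realize_relabel, h]
    constructor
    · rintro ⟨c, a, h'⟩
      exact ⟨_, h'⟩
    · rintro ⟨c, h'⟩
      refine ⟨Fin.init c, c (Fin.last p), ?_⟩
      rwa [Fin.snoc_init_self]

end Formulas

/-! ### Definable sets and their sections -/

section Definable

variable {L : FirstOrder.Language.{u, v}} {M : Type w} [L.Structure M] (𝔐 : Quasistructure L M)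

theorem Quasistructure.mem_def_of_finite {α : Type} [Finite α] {n : ℕ} (φ : AMLFormula L (α ⊕ Fin n))
    (b : α → M) : {x | 𝔐.Realize φ (Sum.elim b x)} ∈ 𝔐.Def n := by
  obtain ⟨p, ⟨e⟩⟩ := Finite.exists_equiv_fin α
  refine ⟨p, φ.relabel (Sum.map e id), b ∘ e.symm, ?_⟩
  ext x
  rw [mem_ofPred_eq, mem_ofPred_eq, realize_relabel, Sum.elim_comp_map]
  simp [Function.comp_assoc]

theorem Quasistructure.preimage_comp_mem_def {m n : ℕ} {E : Set (Fin n → M)} (hE : E ∈ 𝔐.Def n)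
    (σ : Fin n → Fin m) : {z : Fin m → M | z ∘ σ ∈ E} ∈ 𝔐.Def m := by
  obtain ⟨p, φ, b, rfl⟩ := hE
  refine ⟨p, φ.relabel (Sum.map id σ), b, ?_⟩
  ext z
  simp [realize_relabel, Sum.elim_comp_map]

/-- The frozen coordinates `x` join the tuple of parameters. -/
theorem Quasistructure.append_mem_def {m n : ℕ} {E : Set (Fin (m + n) → M)}
    (hE : E ∈ 𝔐.Def (m + n)) (x : Fin m → M) :
    {y : Fin n → M | Fin.append x y ∈ E} ∈ 𝔐.Def n := by
  obtain ⟨p, φ, b, rfl⟩ := hE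
  have := 𝔐.mem_def_of_finite (φ.relabel (Sum.elim (fun j => .inl (.inl j))
    fun i => Sum.elim (fun j => .inl (.inr j)) .inr (finSumFinEquiv.symm i)))
    (Sum.elim b x)
  convert this using 3 with y
  rw [mem_ofPred_eq, realize_relabel]
  congr! 1
  ext (j | i)
  · rfl
  · induction i using Fin.addCases <;> simp

theorem Quasistructure.append_right_mem_def {m n : ℕ} {E : Set (Fin (m + n) → M)}
    (hE : E ∈ 𝔐.Def (m + n)) (y : Fin n → M) :
    {x : Fin m → M | Fin.append x y ∈ E} ∈ 𝔐.Def m := by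
  obtain ⟨p, φ, b, rfl⟩ := hE
  have := 𝔐.mem_def_of_finite (φ.relabel (Sum.elim (fun j => .inl (.inl j))
    fun i => Sum.elim .inr (fun j => .inl (.inr j)) (finSumFinEquiv.symm i)))
    (Sum.elim b y)
  convert this using 3 with x
  rw [mem_ofPred_eq, realize_relabel]
  congr! 1
  ext (j | i)
  · rfl
  · induction i using Fin.addCases <;> simp

/-- The generators of `algB` already form an algebra of sets. -/
theorem mem_algB_iff {A : Set M} {n : ℕ} {I : Finset (Fin n)} {X : Set (Fin n → M)} :
    X ∈ algB 𝔐 A n I ↔ ∃ (p : ℕ) (φ : AMLFormula L (Fin p ⊕ I)) (b : Fin p → M),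
      (∀ j, b j ∈ A) ∧ X = {x | 𝔐.Realize φ (Sum.elim b (fun i : I => x i))} := by
  refine ⟨fun h => ?_, fun h => self_subset_generateSetAlgebra h⟩
  induction h with
  | base s hs => exact hs
  | empty =>
    refine ⟨0, .not .top, Fin.elim0, fun j => j.elim0, ?_⟩
    ext x
    simpa [Quasistructure.Realize] using 𝔐.realize_top _
  | compl s _ hs =>
    obtain ⟨p, φ, b, hb, rfl⟩ := hs
    refine ⟨p, .not φ, b, hb, ?_⟩
    ext x
    simp [Quasistructure.Realize]
  | union s t _ _ hs ht =>
    obtain ⟨p, φ, b, hb, rfl⟩ := hs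
    obtain ⟨q, ψ, c, hc, rfl⟩ := ht
    -- Disjunction is expressed by De Morgan, over the concatenated parameter tuples.
    refine ⟨p + q, .not (.and (.not (φ.relabel (Sum.map (Fin.castAdd q) id)))
      (.not (ψ.relabel (Sum.map (Fin.natAdd p) id)))), Fin.append b c, fun j => ?_, ?_⟩
    · induction j using Fin.addCases with
      | left i => simpa using hb i
      | right i => simpa using hc i
    · ext x
      have h1 : Fin.append b c ∘ Fin.castAdd q = b := by ext; simp
      have h2 : Fin.append b c ∘ Fin.natAdd p = c := by ext; simp
      simp only [mem_union, mem_ofPred_eq, Quasistructure.Realize,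
        Quasistructure.realize_relabel, Sum.elim_comp_map, h1, h2]
      simp only [Function.comp_id]
      tauto

theorem isSetAlgebra_algB {A : Set M} {n : ℕ} {I : Finset (Fin n)} :
    IsSetAlgebra (algB 𝔐 A n I) := isSetAlgebra_generateSetAlgebra

theorem algB_mono {A : Set M} {n : ℕ} : Monotone (algB 𝔐 A n) := by
  intro I J hIJ X hX
  obtain ⟨p, φ, b, hb, rfl⟩ := (mem_algB_iff 𝔐).1 hX
  refine (mem_algB_iff 𝔐).2 ⟨p, φ.relabel (Sum.map id fun i => ⟨i.1, hIJ i.2⟩), b, hb, ?_⟩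
  ext x
  simp only [mem_ofPred_eq, Quasistructure.realize_relabel, Sum.elim_comp_map]
  rfl

theorem algB_subset_def {A : Set M} {n : ℕ} {I : Finset (Fin n)} : algB 𝔐 A n I ⊆ 𝔐.Def n := by
  intro X hX
  obtain ⟨p, φ, b, hb, rfl⟩ := (mem_algB_iff 𝔐).1 hX
  refine ⟨p, φ.relabel (Sum.map id fun i => i.1), b, ?_⟩
  ext x
  simp only [mem_ofPred_eq, Quasistructure.realize_relabel, Sum.elim_comp_map]
  rfl

/-- Membership in a set that is defined over the coordinates in `I` depends only on
these coordinates. -/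
theorem mem_iff_of_mem_algB {A : Set M} {n : ℕ} {I : Finset (Fin n)} {X : Set (Fin n → M)}
    (hX : X ∈ algB 𝔐 A n I) {x y : Fin n → M} (hxy : ∀ i ∈ I, x i = y i) : x ∈ X ↔ y ∈ X := by
  obtain ⟨p, φ, b, hb, rfl⟩ := (mem_algB_iff 𝔐).1 hX
  have : (fun i : I => x i) = fun i : I => y i := funext fun i => hxy i i.2
  simp only [mem_ofPred_eq, this]

open Classical in
/-- The tuple that agrees with `x` on `S` and with `y` off `S`. -/
noncomputable def mix {M : Type w} {n : ℕ} (S : Finset (Fin n)) (x y : Fin n → M) : Fin n → M :=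
  fun i => if i ∈ S then x i else y i

theorem mix_of_mem {M : Type w} {n : ℕ} {S : Finset (Fin n)} (x y : Fin n → M) {i : Fin n}
    (hi : i ∈ S) : mix S x y i = x i := if_pos hi

theorem mix_of_notMem {M : Type w} {n : ℕ} {S : Finset (Fin n)} (x y : Fin n → M) {i : Fin n}
    (hi : i ∉ S) : mix S x y i = y i := if_neg hi

/-- Fixing the coordinates off `S` leaves a set defined over the coordinates in `J ∩ S`. -/
theorem mix_mem_algB {A : Set M} {n : ℕ} {J S : Finset (Fin n)} {X : Set (Fin n → M)}
    (hX : X ∈ algB 𝔐 A n J) {y : Fin n → M} (hy : ∀ i, y i ∈ A) :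
    {x | mix S x y ∈ X} ∈ algB 𝔐 A n (J ∩ S) := by
  classical
  obtain ⟨p, φ, b, hb, rfl⟩ := (mem_algB_iff 𝔐).1 hX
  refine (mem_algB_iff 𝔐).2 ⟨p + n, φ.relabel (Sum.elim (fun j => .inl (Fin.castAdd n j))
    fun i => if h : i.1 ∈ S then .inr ⟨i.1, Finset.mem_inter.2 ⟨i.2, h⟩⟩ else
      .inl (Fin.natAdd p i.1)), Fin.append b y, fun j => ?_, ?_⟩
  · induction j using Fin.addCases with
    | left i => simpa using hb i
    | right i => simpa using hy i
  · ext x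
    simp only [mem_ofPred_eq, Quasistructure.realize_relabel]
    congr! 1
    ext (j | i)
    · simp
    · by_cases h : i.1 ∈ S
      · simp [h, mix_of_mem]
      · simp [h, mix_of_notMem]

end Definable

/-! ### Fubini and invariance under permutations of coordinates -/

section Permutation

variable {L : FirstOrder.Language.{u, v}} {N : Type w} [L.Structure N]
  (𝔑 : MeasuredStructure L N)

theorem MeasuredStructure.ν_eq_lintegral_left {m n : ℕ} (hm : 0 < m) (hn : 0 < n)
    {B : Set (Fin (m + n) → N)} (hB : B ∈ 𝔑.Def (m + n)) :
    𝔑.ν (m + n) B = ∫⁻ x, 𝔑.ν n {y : Fin n → N | Fin.append x y ∈ B} ∂(𝔑.ν m) :=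
  (𝔑.fubini m n hm hn B (𝔑.measurableSet_of_mem_def _ (by omega) B hB)).2.2.2.2.1

theorem MeasuredStructure.ν_eq_lintegral_right {m n : ℕ} (hm : 0 < m) (hn : 0 < n)
    {B : Set (Fin (m + n) → N)} (hB : B ∈ 𝔑.Def (m + n)) :
    𝔑.ν (m + n) B = ∫⁻ y, 𝔑.ν m {x : Fin m → N | Fin.append x y ∈ B} ∂(𝔑.ν n) :=
  (𝔑.fubini m n hm hn B (𝔑.measurableSet_of_mem_def _ (by omega) B hB)).2.2.2.2.2

theorem append_comp_swap_castAdd {m n : ℕ} (x : Fin m → N) (y : Fin n → N) (a b : Fin m) :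
    Fin.append x y ∘ Equiv.swap (Fin.castAdd n a) (Fin.castAdd n b) =
      Fin.append (x ∘ Equiv.swap a b) y := by
  ext i
  induction i using Fin.addCases with
  | left i =>
    have : Equiv.swap (Fin.castAdd n a) (Fin.castAdd n b) (Fin.castAdd n i) =
        Fin.castAdd n (Equiv.swap a b i) := by
      simp only [Equiv.swap_apply_def, Fin.castAdd_inj]
      split_ifs <;> rfl
    simp [this]
  | right i =>
    have : Equiv.swap (Fin.castAdd n a) (Fin.castAdd n b) (Fin.natAdd m i) = Fin.natAdd m i :=
      Equiv.swap_apply_of_ne_of_ne (by simp [Fin.ext_iff]; omega) (by simp [Fin.ext_iff]; omega)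
    simp [this]

theorem append_comp_swap_natAdd {m n : ℕ} (x : Fin m → N) (y : Fin n → N) (a b : Fin n) :
    Fin.append x y ∘ Equiv.swap (Fin.natAdd m a) (Fin.natAdd m b) =
      Fin.append x (y ∘ Equiv.swap a b) := by
  ext i
  induction i using Fin.addCases with
  | left i =>
    have : Equiv.swap (Fin.natAdd m a) (Fin.natAdd m b) (Fin.castAdd n i) = Fin.castAdd n i :=
      Equiv.swap_apply_of_ne_of_ne (by simp [Fin.ext_iff]; omega) (by simp [Fin.ext_iff]; omega)
    simp [this]
  | right i =>
    have : Equiv.swap (Fin.natAdd m a) (Fin.natAdd m b) (Fin.natAdd m i) =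
        Fin.natAdd m (Equiv.swap a b i) := by
      simp only [Equiv.swap_apply_def, Fin.natAdd_inj]
      split_ifs <;> rfl
    simp [this]

/-- Both sides are iterated integrals of the same sections, taken in the two orders. -/
theorem MeasuredStructure.ν_preimage_swap_two {E : Set (Fin 2 → N)} (hE : E ∈ 𝔑.Def 2) :
    𝔑.ν 2 {z | z ∘ Equiv.swap 0 1 ∈ E} = 𝔑.ν 2 E := by
  have h1 := 𝔑.ν_eq_lintegral_left (m := 1) (n := 1) one_pos one_pos
    (𝔑.preimage_comp_mem_def hE (Equiv.swap 0 1))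
  refine h1.trans ((𝔑.ν_eq_lintegral_right (m := 1) (n := 1) one_pos one_pos hE).trans ?_).symm
  have : ∀ x y : Fin 1 → N, (Fin.append y x : Fin 2 → N) ∘ Equiv.swap (0 : Fin 2) 1 =
      Fin.append x y := fun x y => by
    ext i
    fin_cases i
    · change Fin.append y x (Fin.natAdd 1 0) = Fin.append x y (Fin.castAdd 1 0)
      rw [Fin.append_left, Fin.append_right]
    · change Fin.append y x (Fin.castAdd 1 0) = Fin.append x y (Fin.natAdd 1 0)
      rw [Fin.append_left, Fin.append_right]
  refine lintegral_congr fun y => ?_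
  congr 1
  ext x
  rw [mem_ofPred_eq, mem_ofPred_eq, mem_ofPred_eq, this]

/-- A swap that avoids the last coordinate acts on sections over that coordinate, which gives an
induction; a swap of the last two acts on sections over the first `i`. The case `i = 0` is separate
since Fubini needs nonempty blocks. -/
theorem MeasuredStructure.ν_preimage_swap_adjacent {n i : ℕ} (hi : i + 1 < n)
    {E : Set (Fin n → N)} (hE : E ∈ 𝔑.Def n) :
    𝔑.ν n {z | z ∘ Equiv.swap ⟨i, by omega⟩ ⟨i + 1, hi⟩ ∈ E} = 𝔑.ν n E := by
  induction n with
  | zero => omega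
  | succ m ih =>
    by_cases him : i + 1 < m
    · rw [𝔑.ν_eq_lintegral_right (by omega) one_pos hE, 𝔑.ν_eq_lintegral_right (by omega) one_pos
        (𝔑.preimage_comp_mem_def hE _)]
      refine lintegral_congr fun y => ?_
      rw [← ih him (𝔑.append_right_mem_def hE y)]
      congr 1
      ext x
      exact iff_of_eq (congrArg (· ∈ E)
        (append_comp_swap_castAdd x y ⟨i, by omega⟩ ⟨i + 1, him⟩))
    · obtain rfl : m = i + 1 := by omega
      rcases Nat.eq_zero_or_pos i with rfl | hi0
      · exact 𝔑.ν_preimage_swap_two hE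
      · refine (𝔑.ν_eq_lintegral_left (m := i) (n := 2) hi0 two_pos
          (𝔑.preimage_comp_mem_def hE _)).trans
          ((𝔑.ν_eq_lintegral_left (m := i) (n := 2) hi0 two_pos hE).trans ?_).symm
        refine lintegral_congr fun x => ?_
        rw [← 𝔑.ν_preimage_swap_two (𝔑.append_mem_def (m := i) (n := 2) hE x)]
        congr 1
        ext y
        exact iff_of_eq (congrArg (· ∈ E) (append_comp_swap_natAdd x y 0 1).symm)

/-- The measures of definable sets are invariant under permutations of the coordinates. -/
theorem MeasuredStructure.ν_preimage_perm {n : ℕ} (σ : Equiv.Perm (Fin n))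
    {E : Set (Fin n → N)} (hE : E ∈ 𝔑.Def n) : 𝔑.ν n {z | z ∘ σ ∈ E} = 𝔑.ν n E := by
  cases n with
  | zero => rw [Subsingleton.elim σ 1]; rfl
  | succ n =>
    have hσ : σ ∈ Submonoid.closure (range fun i : Fin n => Equiv.swap i.castSucc i.succ) := by
      rw [Equiv.Perm.mclosure_swap_castSucc_succ]; trivial
    induction hσ using Submonoid.closure_induction generalizing E with
    | mem τ hτ =>
      obtain ⟨i, rfl⟩ := hτ
      exact 𝔑.ν_preimage_swap_adjacent (i := i) (by omega) hE
    | one => rfl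
    | mul τ τ' _ _ h h' =>
      rw [← h' hE, ← h (𝔑.preimage_comp_mem_def hE τ')]
      rfl

theorem MeasuredStructure.ν_univ_succ {n : ℕ} (hn : 0 < n) :
    𝔑.ν (n + 1) univ = 𝔑.ν n univ * 𝔑.ν 1 univ := by
  rw [← 𝔑.ν_rect n 1 hn one_pos univ univ (@MeasurableSet.univ _ (𝔑.mspace n))
    (@MeasurableSet.univ _ (𝔑.mspace 1))]
  congr 1
  ext z
  simp [rect]

theorem MeasuredStructure.ν_univ_ne {n : ℕ} (hn : 0 < n) (hfin : 𝔑.ν 1 univ ≠ ⊤)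
    (hpos : 𝔑.ν 1 univ ≠ 0) : 𝔑.ν n univ ≠ ⊤ ∧ 𝔑.ν n univ ≠ 0 := by
  induction n, hn using Nat.le_induction with
  | base => exact ⟨hfin, hpos⟩
  | succ n hn ih =>
    rw [𝔑.ν_univ_succ hn]
    exact ⟨ENNReal.mul_ne_top ih.1 hfin, mul_ne_zero ih.2 hpos⟩

/-- The permutation of a doubled index set that exchanges the two copies off `S`. -/
def exchange {n : ℕ} (S : Finset (Fin n)) : Equiv.Perm (Fin (n + n)) :=
  Function.Involutive.toPerm
    (Fin.addCases (fun i => if i ∈ S then Fin.castAdd n i else Fin.natAdd n i)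
      fun i => if i ∈ S then Fin.natAdd n i else Fin.castAdd n i) (by
    intro i
    induction i using Fin.addCases with
    | left i => by_cases h : i ∈ S <;> simp [-Fin.natAdd_eq_addNat, h]
    | right i => by_cases h : i ∈ S <;> simp [-Fin.natAdd_eq_addNat, h])

theorem exchange_castAdd {n : ℕ} (S : Finset (Fin n)) (i : Fin n) :
    exchange S (Fin.castAdd n i) = if i ∈ S then Fin.castAdd n i else Fin.natAdd n i :=
  Fin.addCases_left (motive := fun _ => Fin (n + n))
    (left := fun i => if i ∈ S then Fin.castAdd n i else Fin.natAdd n i)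
    (right := fun i => if i ∈ S then Fin.natAdd n i else Fin.castAdd n i) i

theorem append_exchange_castAdd {n : ℕ} (S : Finset (Fin n)) (x y : Fin n → N) :
    (fun i => (Fin.append x y ∘ exchange S) (Fin.castAdd n i)) = mix S x y := by
  ext i
  by_cases h : i ∈ S <;> simp [-Fin.natAdd_eq_addNat, exchange_castAdd, mix, h]

/-- Averaging over the coordinates off `S`. -/
theorem MeasuredStructure.lintegral_ν_mix {n : ℕ} (hn : 0 < n) (S : Finset (Fin n))
    {E : Set (Fin n → N)} (hE : E ∈ 𝔑.Def n) :
    AEMeasurable (fun y => 𝔑.ν n {x | mix S x y ∈ E}) (𝔑.ν n) ∧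
      ∫⁻ y, 𝔑.ν n {x | mix S x y ∈ E} ∂(𝔑.ν n) = 𝔑.ν n E * 𝔑.ν n univ := by
  -- In doubled coordinates, exchanging the copies off `S` turns `E × N ^ n` into a set of the same
  -- measure whose section at `y` is `{x | mix S x y ∈ E}`.
  have hR : rect E (univ : Set (Fin n → N)) ∈ 𝔑.Def (n + n) := by
    have := 𝔑.preimage_comp_mem_def hE (Fin.castAdd n)
    convert this using 1
    ext z
    simp [rect, Function.comp_def]
  have hR' := 𝔑.preimage_comp_mem_def hR (exchange S)
  have hset : ∀ y, {x | Fin.append x y ∈ {z : Fin (n + n) → N | z ∘ exchange S ∈ rect E univ}} =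
      {x | mix S x y ∈ E} := fun y => by
    ext x
    rw [mem_ofPred_eq, mem_ofPred_eq, rect, mem_ofPred_eq, append_exchange_castAdd]
    simp
  obtain ⟨-, -, -, h1, -, h2⟩ := 𝔑.fubini n n hn hn _
    (𝔑.measurableSet_of_mem_def _ (by omega) _ hR')
  simp only [hset] at h1 h2
  refine ⟨h1, ?_⟩
  rw [← h2, 𝔑.ν_preimage_perm _ hR, 𝔑.ν_rect n n hn hn _ _
    (𝔑.measurableSet_of_mem_def _ hn _ hE) (@MeasurableSet.univ _ (𝔑.mspace n))]

end Permutation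

/-! ### Approximating parameters from `N` by parameters from `M` -/

section Elementarity

variable {L : FirstOrder.Language.{u, v}} {N : Type w} [L.Structure N]
  {𝔑 : MeasuredStructure L N} {M : L.Substructure N} {𝔐 : AMLStructure L M}

theorem IsElementarySubstructure.realize_iff_of_finite
    (hMN : IsElementarySubstructure 𝔐 𝔑.toAMLStructure) {α : Type} [Finite α]
    (φ : AMLFormula L α) (a : α → M) :
    𝔐.Realize φ a ↔ 𝔑.Realize φ (fun i => (a i : N)) := by
  obtain ⟨p, ⟨e⟩⟩ := Finite.exists_equiv_fin α
  have := hMN.realize_iff p (φ.relabel e) (a ∘ e.symm)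
  rw [Quasistructure.realize_relabel, Quasistructure.realize_relabel] at this
  simpa [Function.comp_def] using this

theorem IsElementarySubstructure.exists_realize
    (hMN : IsElementarySubstructure 𝔐 𝔑.toAMLStructure) {α : Type} [Finite α] {q : ℕ}
    (φ : AMLFormula L (α ⊕ Fin q)) (a : α → M) (c : Fin q → N)
    (h : 𝔑.Realize φ (Sum.elim (fun i => (a i : N)) c)) :
    ∃ c : Fin q → M, 𝔑.Realize φ (Sum.elim (fun i => (a i : N)) fun i => (c i : N)) := by
  obtain ⟨c', hc'⟩ := (Quasistructure.realize_exs _ φ a).1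
    ((hMN.realize_iff_of_finite φ.exs a).2 ((Quasistructure.realize_exs _ φ _).2 ⟨c, h⟩))
  refine ⟨c', ?_⟩
  have := (hMN.realize_iff_of_finite φ _).1 hc'
  convert this using 1
  ext (i | i) <;> rfl

/-- The measures of the sections of finitely many sets defined over `M`, at a tuple of
parameters from `N`, are bounded up to `ε` by those at a tuple of parameters from `M`. -/
theorem IsElementarySubstructure.exists_ν_mix_le
    (hMN : IsElementarySubstructure 𝔐 𝔑.toAMLStructure) {n : ℕ} (hn : 0 < n)
    (hfin : 𝔑.ν n univ ≠ ⊤) (S : Finset (Fin n)) {κ : Type} [Fintype κ]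
    {E : κ → Set (Fin n → N)}
    (hE : ∀ k, E k ∈ algB 𝔑.toQuasistructure (M : Set N) n Finset.univ)
    (y : Fin n → N) {ε : ℝ} (hε : 0 < ε) :
    ∃ y' : Fin n → N, (∀ i, y' i ∈ M) ∧
      ∀ k, (𝔑.ν n).real {x | mix S x y' ∈ E k} ≤ (𝔑.ν n).real {x | mix S x y ∈ E k} + ε := by
  classical
  have hne : ∀ s, 𝔑.ν n s ≠ ⊤ := fun s => ne_top_of_le_ne_top hfin (measure_mono (subset_univ s))
  choose p φ b hb hEφ using fun k => (mem_algB_iff _).1 (hE k)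
  -- Strict rational upper bounds make the conjunction `θ` of formulas `measLT` true at `y`,
  -- whatever the tags.
  have hr : ∀ k, ∃ r : ℚ≥0, 𝔑.ν n {x | mix S x y ∈ E k} < ((r : ℝ≥0) : ℝ≥0∞) ∧
      (r : ℝ) ≤ (𝔑.ν n).real {x | mix S x y ∈ E k} + ε := fun k => by
    obtain ⟨r, hr, hr'⟩ := exists_rat_btwn (lt_add_of_pos_right
      ((𝔑.ν n).real {x | mix S x y ∈ E k}) hε)
    have hr0 : 0 ≤ r := by
      have := lt_of_le_of_lt measureReal_nonneg hr
      exact_mod_cast this.le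
    lift r to ℚ≥0 using hr0
    refine ⟨r, ?_, by exact_mod_cast hr'.le⟩
    rw [← ENNReal.toReal_lt_toReal (hne _) ENNReal.coe_ne_top]
    exact_mod_cast hr
  choose r hr hr' using hr
  let α := Σ k, Fin (p k)
  let ψ : ∀ k, AMLFormula L ((α ⊕ Fin n) ⊕ Fin n) := fun k => (φ k).relabel
    (Sum.elim (fun j => .inl (.inl ⟨k, j⟩)) fun i => if i.1 ∈ S then .inr i.1 else .inl (.inr i.1))
  let a : α → M := fun j => ⟨b j.1 j.2, hb j.1 j.2⟩
  have hψ : ∀ k (y : Fin n → N), {x | 𝔑.Realize (ψ k) (Sum.elim (Sum.elim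
      (fun j => (a j : N)) y) x)} = {x | mix S x y ∈ E k} := fun k y => by
    ext x
    rw [hEφ k]
    simp only [mem_ofPred_eq, ψ, Quasistructure.realize_relabel]
    congr! 1
    ext (j | i)
    · rfl
    · by_cases h : i.1 ∈ S
      · simp [h, mix_of_mem]
      · simp [h, mix_of_notMem]
  have hμ : ∀ k (y : Fin n → N), 𝔑.μ n {x | 𝔑.Realize (ψ k) (Sum.elim (Sum.elim
      (fun j => (a j : N)) y) x)} = 𝔑.ν n {x | mix S x y ∈ E k} := fun k y => by
    rw [← 𝔑.ν_eq_μ n hn _ (𝔑.mem_def_of_finite (ψ k) _), hψ]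
  let θ : AMLFormula L (α ⊕ Fin n) :=
    .conj (Finset.univ.toList.map fun k => .measLT n hn (r k) (ψ k))
  obtain ⟨c, hc⟩ := hMN.exists_realize θ a y (by
    rw [Quasistructure.realize_conj]
    intro χ hχ
    obtain ⟨k, -, rfl⟩ := List.mem_map.1 hχ
    refine Or.inl ?_
    rw [hμ]
    exact hr k)
  refine ⟨fun i => c i, fun i => (c i).2, fun k => le_trans ?_ (hr' k)⟩
  have h1 := (Quasistructure.realize_conj _ _ _).1 hc _
    (List.mem_map.2 ⟨k, Finset.mem_toList.2 (Finset.mem_univ k), rfl⟩)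
  -- Only `≤` survives: `measLT` also holds at equality with tag `below`.
  have h2 : 𝔑.ν n {x | mix S x (fun i => (c i : N)) ∈ E k} ≤ ((r k : ℝ≥0) : ℝ≥0∞) := by
    rw [← hμ]
    exact h1.elim le_of_lt fun h => h.1.le
  have h3 := ENNReal.toReal_mono ENNReal.coe_ne_top h2
  exact_mod_cast h3

/-- The measures of the sections of finitely many sets defined over `M`, at a tuple of
parameters from `N`, are approximated by those at a tuple of parameters from `M`. -/
theorem IsElementarySubstructure.exists_ν_mix_approx
    (hMN : IsElementarySubstructure 𝔐 𝔑.toAMLStructure) {n : ℕ} (hn : 0 < n)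
    (hfin : 𝔑.ν n univ ≠ ⊤) (S : Finset (Fin n)) {κ : Type} [Fintype κ]
    {E : κ → Set (Fin n → N)}
    (hE : ∀ k, E k ∈ algB 𝔑.toQuasistructure (M : Set N) n Finset.univ)
    (y : Fin n → N) {ε : ℝ} (hε : 0 < ε) :
    ∃ y' : Fin n → N, (∀ i, y' i ∈ M) ∧ ∀ k,
      |(𝔑.ν n).real {x | mix S x y' ∈ E k} - (𝔑.ν n).real {x | mix S x y ∈ E k}| ≤ ε := by
  let m0 := 𝔑.mspace n
  have : IsFiniteMeasure (𝔑.ν n) := ⟨hfin.lt_top⟩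
  -- Upper bounds for the complements are lower bounds for the sets, as the total measure is finite.
  obtain ⟨y', hy', h⟩ := hMN.exists_ν_mix_le hn hfin S
    (E := Sum.elim E fun k => (E k)ᶜ) (by
      rintro (k | k)
      exacts [hE k, (isSetAlgebra_algB _).compl_mem (hE k)]) y hε
  refine ⟨y', hy', fun k => ?_⟩
  have hcompl : ∀ z : Fin n → N, (𝔑.ν n).real {x | mix S x z ∈ (E k)ᶜ} =
      (𝔑.ν n).real univ - (𝔑.ν n).real {x | mix S x z ∈ E k} := fun z => by
    obtain ⟨p, φ, b, -, hφ⟩ := (mem_algB_iff _).1 (hE k)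
    have hdef : {x | mix S x z ∈ E k} ∈ 𝔑.Def n := by
      refine algB_subset_def (A := univ) (I := Finset.univ ∩ S) _ (mix_mem_algB _ ?_ fun i => trivial)
      exact (mem_algB_iff _).2 ⟨p, φ, b, fun _ => trivial, hφ⟩
    exact measureReal_compl (𝔑.measurableSet_of_mem_def n hn _ hdef)
  have h1 := h (.inl k)
  have h2 := h (.inr k)
  simp only [Sum.elim_inl, Sum.elim_inr, hcompl] at h1 h2
  rw [abs_le]
  constructor <;> linarith

end Elementarity

/-! ### Density of step functions -/

section Simple

variable {X : Type*}

/-- Integrable functions are approximated in the mean by step functions over a generating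
algebra. -/
theorem exists_step_approx {m0 : MeasurableSpace X} {μ : Measure X} [IsFiniteMeasure μ]
    {𝒜 : Set (Set X)} (h𝒜 : IsSetAlgebra 𝒜) (hm : generateFrom 𝒜 ≤ m0) {f : X → ℝ}
    (hf : Integrable f μ) (hfm : StronglyMeasurable[generateFrom 𝒜] f) {ε : ℝ} (hε : 0 < ε) :
    ∃ (κ : Type) (_ : Fintype κ) (c : κ → ℝ) (A : κ → Set X), (∀ k, A k ∈ 𝒜) ∧
      ∫ x, |f x - ∑ k, (A k).indicator (fun _ => c k) x| ∂μ ≤ ε := by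
  let m1 := generateFrom 𝒜
  have hfin : IsFiniteMeasure (μ.trim hm) := isFiniteMeasure_trim hm
  let P : (X → ℝ) → Prop := fun g => ∃ (κ : Type) (_ : Fintype κ) (c : κ → ℝ) (A : κ → Set X),
    (∀ k, A k ∈ 𝒜) ∧ g = fun x => ∑ k, (A k).indicator (fun _ => c k) x
  have hmeas : ∀ g, P g → StronglyMeasurable[m1] g := by
    rintro g ⟨κ, _, c, A, hA, rfl⟩
    exact Finset.stronglyMeasurable_fun_sum _ fun k _ =>
      stronglyMeasurable_const.indicator (measurableSet_generateFrom (hA k))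
  -- Density is applied to the trimmed measure, so only sets of the generated σ-algebra have to be
  -- approximated.
  have hdense := MemLp.induction_dense (μ := μ.trim hm) (p := 1) ENNReal.one_ne_top P ?_ ?_
    (fun g hg => (hmeas g hg).aestronglyMeasurable)
    (memLp_one_iff_integrable.2 (hf.trim hm hfm)) (ENNReal.ofReal_pos.2 hε).ne'
  · obtain ⟨g, hg, hPg⟩ := hdense
    have hgm := hmeas g hPg
    obtain ⟨κ, hκ, c, A, hA, rfl⟩ := hPg
    refine ⟨κ, hκ, c, A, hA, ?_⟩
    have hsm := hfm.sub hgm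
    rw [eLpNorm_one_eq_lintegral_enorm] at hg
    have := integral_norm_eq_lintegral_enorm (μ := μ.trim hm) hsm.aestronglyMeasurable
    rw [← integral_trim hm hsm.norm] at this
    simp only [Pi.sub_apply, Real.norm_eq_abs] at this
    rw [this]
    exact ENNReal.toReal_le_of_le_ofReal hε.le hg
  · intro c s hs _ η hη
    obtain ⟨η', hη', hηη'⟩ : ∃ η' : ℝ, 0 < η' ∧ ENNReal.ofReal η' ≤ η := by
      rcases eq_or_ne η ⊤ with rfl | h
      · exact ⟨1, one_pos, le_top⟩
      · exact ⟨η.toReal, ENNReal.toReal_pos hη h, ENNReal.ofReal_toReal_le⟩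
    obtain ⟨t, ht, hst⟩ := exists_symmDiff_lt (μ.trim hm) h𝒜 le_rfl hs
      (ε := η' / (|c| + 1)) (by positivity)
    refine ⟨t.indicator fun _ => c, ?_, Unit, inferInstance, fun _ => c, fun _ => t,
      fun _ => ht, by ext; simp⟩
    rw [eLpNorm_indicator_sub_indicator]
    refine le_trans (eLpNorm_indicator_const_le c 1) (le_trans ?_ hηη')
    rw [symmDiff_comm] at hst
    have h1 : |c| * (μ.trim hm).real (symmDiff t s) ≤ η' := by
      rw [lt_div_iff₀ (by positivity)] at hst
      nlinarith [measureReal_nonneg (μ := μ.trim hm) (s := symmDiff t s)]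
    simp only [ENNReal.toReal_one, div_one, ENNReal.rpow_one]
    rw [← ofReal_measureReal, ← ofReal_norm, ← ENNReal.ofReal_mul (norm_nonneg _)]
    exact ENNReal.ofReal_le_ofReal h1
  · rintro _ _ ⟨κ, _, c, A, hA, rfl⟩ ⟨κ', _, c', A', hA', rfl⟩
    refine ⟨κ ⊕ κ', inferInstance, Sum.elim c c', Sum.elim A A', ?_, ?_⟩
    · rintro (k | k)
      exacts [hA k, hA' k]
    · ext x; simp

end Simple

/-! ### Conditional independence over an elementary substructure -/

section Independence

/-- One step function serves all `D` with the same error, so it can be fixed before the frozen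
coordinates vary. -/
theorem abs_setIntegral_sub_step_le {X : Type*} {m0 : MeasurableSpace X} {μ : Measure X}
    [IsFiniteMeasure μ] {f : X → ℝ} (hf : Integrable f μ) {κ : Type} [Fintype κ] {c : κ → ℝ}
    {A : κ → Set X} (hA : ∀ k, MeasurableSet (A k)) {η : ℝ}
    (h : ∫ x, |f x - ∑ k, (A k).indicator (fun _ => c k) x| ∂μ ≤ η) (D : Set X) :
    |∫ x in D, f x ∂μ - ∑ k, c k * μ.real (A k ∩ D)| ≤ η := by
  have hi : ∀ k, Integrable ((A k).indicator fun _ => c k) μ :=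
    fun k => (integrable_const _).indicator (hA k)
  have hs : Integrable (fun x => ∑ k, (A k).indicator (fun _ => c k) x) μ :=
    integrable_finsetSum _ fun k _ => hi k
  have h1 : ∑ k, c k * μ.real (A k ∩ D) =
      ∫ x in D, ∑ k, (A k).indicator (fun _ => c k) x ∂μ := by
    rw [integral_finsetSum _ fun k _ => (hi k).integrableOn]
    refine Finset.sum_congr rfl fun k _ => ?_
    rw [integral_indicator (hA k), Measure.restrict_restrict (hA k)]
    simp [mul_comm]
  rw [h1, ← integral_sub hf.integrableOn hs.integrableOn]
  refine le_trans abs_integral_le_integral_abs (le_trans ?_ h)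
  exact setIntegral_le_integral (hf.sub hs).abs (ae_of_all _ fun x => abs_nonneg _)

variable {L : FirstOrder.Language.{u, v}} {N : Type w} [L.Structure N]
  {𝔑 : MeasuredStructure L N} {M : L.Substructure N} {𝔐 : AMLStructure L M}

theorem MeasuredStructure.generateFrom_algB_le {n : ℕ} (hn : 0 < n) (A : Set N)
    (S : Finset (Fin n)) : generateFrom (algB 𝔑.toQuasistructure A n S) ≤ 𝔑.mspace n :=
  generateFrom_le fun _ hs => 𝔑.measurableSet_of_mem_def n hn _ (algB_subset_def _ hs)

/-- A linear combination of the measures of sections that is small at the parameters from `M` is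
small on average. -/
theorem IsElementarySubstructure.abs_sum_ν_le
    (hMN : IsElementarySubstructure 𝔐 𝔑.toAMLStructure) {n : ℕ} (hn : 0 < n)
    (hfin : 𝔑.ν n univ ≠ ⊤) (hpos : 𝔑.ν n univ ≠ 0) (S : Finset (Fin n)) {κ : Type} [Fintype κ]
    {E : κ → Set (Fin n → N)}
    (hE : ∀ k, E k ∈ algB 𝔑.toQuasistructure (M : Set N) n Finset.univ) (c : κ → ℝ) {η : ℝ}
    (hη : 0 < η) (h : ∀ y : Fin n → N, (∀ i, y i ∈ M) →
      |∑ k, c k * (𝔑.ν n).real {x | mix S x y ∈ E k}| ≤ η) :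
    |∑ k, c k * (𝔑.ν n).real (E k)| ≤ 2 * η := by
  let m0 := 𝔑.mspace n
  have : IsFiniteMeasure (𝔑.ν n) := ⟨hfin.lt_top⟩
  -- Moving `y` into `M` costs a second `η`, with the error of each section weighted by `|c k|`.
  have h2 : ∀ y, |∑ k, c k * (𝔑.ν n).real {x | mix S x y ∈ E k}| ≤ 2 * η := by
    intro y
    have hc0 : 0 ≤ ∑ k, |c k| := Finset.sum_nonneg fun k _ => abs_nonneg _
    obtain ⟨y', hy', hyy'⟩ := hMN.exists_ν_mix_approx hn hfin S hE y
      (ε := η / (∑ k, |c k| + 1)) (by positivity)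
    have h3 : |∑ k, c k * (𝔑.ν n).real {x | mix S x y' ∈ E k} -
        ∑ k, c k * (𝔑.ν n).real {x | mix S x y ∈ E k}| ≤ η := by
      rw [← Finset.sum_sub_distrib]
      calc _ ≤ ∑ k, |c k * (𝔑.ν n).real {x | mix S x y' ∈ E k} -
            c k * (𝔑.ν n).real {x | mix S x y ∈ E k}| := Finset.abs_sum_le_sum_abs _ _
        _ ≤ ∑ k, |c k| * (η / (∑ k, |c k| + 1)) := by
            refine Finset.sum_le_sum fun k _ => ?_
            rw [← mul_sub, abs_mul]
            exact mul_le_mul_of_nonneg_left (hyy' k) (abs_nonneg _)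
        _ = (∑ k, |c k|) / (∑ k, |c k| + 1) * η := by rw [← Finset.sum_mul]; ring
        _ ≤ 1 * η := by
            refine mul_le_mul_of_nonneg_right ?_ hη.le
            rw [div_le_one (by positivity)]
            linarith
        _ = η := one_mul η
    have h4 := h y' hy'
    rw [abs_le] at h3 h4 ⊢
    constructor <;> linarith [h3.1, h3.2, h4.1, h4.2]
  have hT : 0 < (𝔑.ν n).real univ := ENNReal.toReal_pos hpos hfin
  have hv : ∀ k, Integrable (fun y => (𝔑.ν n).real {x | mix S x y ∈ E k}) (𝔑.ν n) ∧
      ∫ y, (𝔑.ν n).real {x | mix S x y ∈ E k} ∂(𝔑.ν n) =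
        (𝔑.ν n).real (E k) * (𝔑.ν n).real univ := fun k => by
    obtain ⟨hm, hint⟩ := 𝔑.lintegral_ν_mix hn S (algB_subset_def _ (hE k))
    refine ⟨?_, ?_⟩
    · refine Integrable.of_bound hm.ennreal_toReal.aestronglyMeasurable ((𝔑.ν n).real univ)
        (ae_of_all _ fun y => ?_)
      rw [Real.norm_of_nonneg measureReal_nonneg]
      exact measureReal_mono (subset_univ _)
    · have := integral_toReal hm (ae_of_all _ fun y => measure_lt_top _ _)
      rw [hint, ENNReal.toReal_mul] at this
      exact this
  have h5 : (∑ k, c k * (𝔑.ν n).real (E k)) * (𝔑.ν n).real univ =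
      ∫ y, ∑ k, c k * (𝔑.ν n).real {x | mix S x y ∈ E k} ∂(𝔑.ν n) := by
    rw [integral_finsetSum _ fun k _ => (hv k).1.const_mul _, Finset.sum_mul]
    refine Finset.sum_congr rfl fun k _ => ?_
    rw [integral_const_mul, (hv k).2, mul_assoc]
  have h6 := norm_integral_le_of_norm_le_const (μ := 𝔑.ν n)
    (f := fun y => ∑ k, c k * (𝔑.ν n).real {x | mix S x y ∈ E k}) (ae_of_all _ h2)
  rw [← h5, Real.norm_eq_abs, abs_mul, abs_of_pos hT] at h6
  exact le_of_mul_le_mul_right h6 hT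

/-- The algebras of sets defined over an elementary substructure are conditionally independent. -/
theorem IsElementarySubstructure.condIndep
    (hMN : IsElementarySubstructure 𝔐 𝔑.toAMLStructure) {n : ℕ} (hn : 0 < n)
    (hfin : 𝔑.ν n univ ≠ ⊤) (hpos : 𝔑.ν n univ ≠ 0) :
    CondIndep (𝔑.ν n) (algB 𝔑.toQuasistructure (M : Set N) n) := by
  classical
  let m0 := 𝔑.mspace n
  have : IsFiniteMeasure (𝔑.ν n) := ⟨hfin.lt_top⟩
  intro 𝓓 h𝓓 S f hf hfm horth
  set 𝒜 := algB 𝔑.toQuasistructure (M : Set N) n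
  have hm : ∀ S, generateFrom (𝒜 S) ≤ m0 := 𝔑.generateFrom_algB_le hn M
  have hmono : Monotone 𝒜 := algB_mono _
  have hlm : ∀ T, generateFrom (lvl 𝒜 𝓓 T) ≤ m0 := fun T =>
    (generateFrom_mono (lvl_subset_of_mono (fun _ => isSetAlgebra_algB _) hmono)).trans (hm T)
  have hbasic : ∀ G ∈ piiUnionInter 𝒜 (𝓓 : Set (Finset (Fin n))),
      ∫ x in G, f x ∂(𝔑.ν n) = 0 := by
    rintro G ⟨t, ht, H, hH, rfl⟩
    set G := ⋂ J ∈ t, H J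
    have hG : G ∈ 𝒜 Finset.univ := (isSetAlgebra_algB _).biInter_mem t
      fun J hJ => hmono (Finset.subset_univ J) (hH J hJ)
    refine abs_eq_zero.1 (le_antisymm (le_of_forall_pos_le_add fun η hη => ?_) (abs_nonneg _))
    rw [zero_add]
    -- One third of `η` is the step approximation on `G`; the other two come from `abs_sum_ν_le`.
    obtain ⟨κ, _, c, A, hA, hfA⟩ := exists_step_approx (isSetAlgebra_algB _) (hm S) hf hfm
      (ε := η / 3) (by positivity)
    have happrox := abs_setIntegral_sub_step_le hf
      (fun k => hm S _ (measurableSet_generateFrom (hA k))) hfA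
    have hsum := hMN.abs_sum_ν_le hn hfin hpos S (E := fun k => A k ∩ G)
      (fun k => (isSetAlgebra_algB _).inter_mem (hmono (Finset.subset_univ S) (hA k)) hG) c
      (η := η / 3) (by positivity) (fun y hy => by
        -- Down-closedness enters here: freezing off `S` moves `H J` to `J ∩ S`, which is still in
        -- `𝓓`.
        have hD : {x | mix S x y ∈ G} ∈ lvl 𝒜 𝓓 S := by
          have : {x | mix S x y ∈ G} = ⋂ J ∈ t, {x | mix S x y ∈ H J} := by
            ext x; simp [G]
          rw [this]
          exact isSetAlgebra_lvl.biInter_mem t fun J hJ => mem_lvl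
            (h𝓓 Finset.inter_subset_left (ht hJ)) Finset.inter_subset_right
            (mix_mem_algB _ (hH J hJ) hy)
        have h1 := happrox {x | mix S x y ∈ G}
        rw [horth _ (measurableSet_generateFrom hD), zero_sub, abs_neg] at h1
        -- Freezing does not affect `A k`, which depends only on coordinates in `S`.
        have h2 : ∀ k, {x | mix S x y ∈ A k ∩ G} = A k ∩ {x | mix S x y ∈ G} := fun k => by
          ext x
          have := mem_iff_of_mem_algB _ (hA k) (x := mix S x y) (y := x)
            fun i hi => mix_of_mem x y hi
          simp [this]
        simpa only [h2] using h1)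
    have h1 := happrox G
    rw [abs_le] at h1 hsum ⊢
    constructor <;> linarith [h1.1, h1.2, hsum.1, hsum.2]
  -- The basic sets form a π-system, so a π-λ argument extends `hbasic`; `huniv` handles
  -- complements.
  have hgen : generateFrom (lvl 𝒜 𝓓 Finset.univ) =
      generateFrom (piiUnionInter 𝒜 (𝓓 : Set (Finset (Fin n)))) := by
    rw [lvl, generateFrom_generateSetAlgebra_eq]
    refine le_antisymm (generateFrom_mono ?_) (generateFrom_le ?_)
    · rintro A ⟨J, hJ, -, hA⟩
      exact subset_piiUnionInter (Finset.mem_coe.2 hJ) hA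
    · rintro _ ⟨t, ht, H, hH, rfl⟩
      exact Finset.measurableSet_biInter _ fun J hJ =>
        measurableSet_generateFrom ⟨J, ht hJ, Finset.subset_univ J, hH J hJ⟩
  have huniv : ∫ x, f x ∂(𝔑.ν n) = 0 := by
    have := horth univ MeasurableSet.univ
    rwa [setIntegral_univ] at this
  intro G hG
  induction G, hG using induction_on_inter hgen (isPiSystem_piiUnionInter _
    (fun J s hs t ht _ => (isSetAlgebra_algB _).inter_mem hs ht) _) with
  | empty => simp
  | basic G hG => exact hbasic G hG
  | compl G hG ih =>
    have := integral_add_compl (hlm _ _ hG) hf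
    rwa [ih, zero_add, huniv] at this
  | iUnion F hdisj hF ih =>
    rw [integral_iUnion (fun i => hlm _ _ (hF i)) hdisj hf.integrableOn]
    simp [ih]

end Independence
end AML

/-- Removal is used with `𝓓` the family of all index sets, so that level `I` contains the whole of
`algB` at `I` and, by monotonicity, nothing more. -/
theorem mainTheorem2 {L : FirstOrder.Language.{u, v}} {N : Type w} [L.Structure N]
    (𝔑 : AML.MeasuredStructure L N)
    (hfin : 𝔑.ν 1 Set.univ ≠ ⊤) (hpos : 𝔑.ν 1 Set.univ ≠ 0)
    (M : L.Substructure N) (𝔐 : AML.AMLStructure L M)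
    (hMN : AML.IsElementarySubstructure 𝔐 𝔑.toAMLStructure)
    (n k : ℕ) (hn : 1 ≤ n) (hkn : k ≤ n)
    (𝓘 : Finset (Finset (Fin n))) (h𝓘 : ∀ I ∈ 𝓘, I.card = k)
    (A : Finset (Fin n) → Set (Fin n → N))
    (hA : ∀ I ∈ 𝓘, MeasurableSet[AML.sigmaB 𝔑.toQuasistructure (M : Set N) n I] (A I))
    (hδ : ∃ δ : ℝ, 0 < δ ∧ ∀ B : Finset (Fin n) → Set (Fin n → N),
      (∀ I ∈ 𝓘, B I ∈ AML.algB 𝔑.toQuasistructure (M : Set N) n I) →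
      (∀ I ∈ 𝓘, 𝔑.ν n (A I \ B I) < ENNReal.ofReal δ) →
      (⋂ I ∈ 𝓘, B I).Nonempty) :
    0 < 𝔑.ν n (⋂ I ∈ 𝓘, A I) := by
  classical
  obtain ⟨δ, hδ0, hδ⟩ := hδ
  obtain ⟨hfin', hpos'⟩ := 𝔑.ν_univ_ne hn hfin hpos
  let m0 := 𝔑.mspace n
  have : IsFiniteMeasure (𝔑.ν n) := ⟨hfin'.lt_top⟩
  have : NeZero (𝔑.ν n) := ⟨fun h => hpos' (by rw [h]; rfl)⟩
  by_contra h0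
  obtain ⟨B, hB, hAB, hempty⟩ := AML.exists_removal (μ := 𝔑.ν n) (𝓓 := Finset.univ)
    (fun S => AML.isSetAlgebra_algB _) (AML.algB_mono _) (𝔑.generateFrom_algB_le hn M)
    (hMN.condIndep hn hfin' hpos') (fun _ _ _ _ => by simp) (ι := 𝓘) (S := fun I => I.1)
    (A := fun I => A I)
    (fun I => MeasurableSpace.generateFrom_mono
      (fun _ hs => AML.mem_lvl (Finset.mem_univ _) (Finset.Subset.refl _) hs) _ (hA I I.2))
    (by rw [Set.iInter_subtype]; exact nonpos_iff_eq_zero.1 (not_lt.1 h0)) hδ0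
  -- The value off `𝓘` is arbitrary.
  obtain ⟨x, hx⟩ := hδ (fun I => if h : I ∈ 𝓘 then B ⟨I, h⟩ else Set.univ)
    (fun I hI => by
      rw [dif_pos hI]
      exact AML.lvl_subset_of_mono (fun _ => AML.isSetAlgebra_algB _) (AML.algB_mono _) (hB ⟨I, hI⟩))
    (fun I hI => by
      rw [dif_pos hI]
      exact (ENNReal.lt_ofReal_iff_toReal_lt (MeasureTheory.measure_ne_top _ _)).2 (hAB ⟨I, hI⟩))
  refine (Set.eq_empty_iff_forall_notMem.1 hempty) x (Set.mem_iInter.2 fun I => ?_)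
  have := Set.mem_iInter₂.1 hx I I.2
  rwa [dif_pos I.2] at this
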